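/- Let $\mathcal H_1,\dots,\mathcal H_N$ be complex separable Hilbert spaces, let $\rho$ be a state (a positive trace class operator of trace one) on $\mathcal H_1\otimes\cdots\otimes\mathcal H_N$, and let $S_1,\dots,S_N\ge 1$ be integers. Let $(\Lambda_n,\mathcal F_{\Lambda_n})$, $n=1,\dots,N$, be standard measurable spaces, and for $n=1,\dots,N$ and $s_n=1,\dots,S_n$ let $\mathrm M_n^{(s_n)}$ be a normalized positive operator-valued measure on $(\Lambda_n,\mathcal F_{\Lambda_n})$ with values in the bounded operators on $\mathcal H_n$. Then the following hold. (1) There is exactly one family of probability measures $P_{(s_1,\dots,s_N)}$ on $\Lambda_1\times\cdots\times\Lambda_N$, $1\le s_n\le S_n$, with $$P_{(s_1,\dots,s_N)}(F_1\times\cdots\times F_N)=\mathrm{tr}\big[\rho\{\mathrm M_1^{(s_1)}(F_1)\otimes\cdots\otimes \mathrm M_N^{(s_N)}(F_N)\}\big]$$ for all $F_n\in\mathcal F_{\Lambda_n}$ (the quantum correlation scenario of $\rho$ and the $\mathrm M_n^{(s_n)}$). (2) This scenario admits a local quasi hidden variable (LqHV) model: there are a measurable space $(\Omega,\mathcal F_\Omega)$,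 a real-valued measure $\nu$ on it that is normalized ($\nu(\Omega)=1$) and bounded, and conditional probability measures $P_n^{(s_n)}(\cdot|\omega)$ on $\Lambda_n$, defined for $\nu$-almost every $\omega$ and such that $\omega\mapsto P_n^{(s_n)}(F|\omega)$ is measurable for every $F\in\mathcal F_{\Lambda_n}$, with $$P_{(s_1,\dots,s_N)}(F_1\times\cdots\times F_N)=\int_\Omega P_1^{(s_1)}(F_1|\omega)\cdots P_N^{(s_N)}(F_N|\omega)\,\nu(\mathrm d\omega)$$ for all $s_1,\dots,s_N$ and all $F_n\in\mathcal F_{\Lambda_n}$. (3) There is a source operator for $\rho$, that is, a self-adjoint trace class operator $T$ on $\mathcal H_1^{\otimes S_1}\otimes\cdots\otimes\mathcal H_N^{\otimes S_N}$ such that, for all bounded operators $X_n$ on $\mathcal H_n$ and every choice of one of the $S_n$ copies of $\mathcal H_n$ at each site $n$, the trace of $T$ times the tensor product of the $X_n$ on the chosen copies and of the identity on all other copies equals $\mathrm{tr}[\rho\{X_1\otimes\cdots\otimes X_N\}]$. (4) For every source operator $T$ for $\rho$ there is a normalized bounded real-valued measure $\mu$ on $\Lambda_1^{S_1}\times\cdots\times\Lambda_N^{S_N}$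 with $$\mu\Big(\prod_{n=1}^N\prod_{s=1}^{S_n}F_n^{(s)}\Big)=\mathrm{tr}\Big[T\Big\{\bigotimes_{n=1}^N\bigotimes_{s=1}^{S_n}\mathrm M_n^{(s)}(F_n^{(s)})\Big\}\Big]$$ for all $F_n^{(s)}\in\mathcal F_{\Lambda_n}$, and, for all $s_1,\dots,s_N$, the marginal of $\mu$ in the coordinates $(\lambda_1^{(s_1)},\dots,\lambda_N^{(s_N)})$ is $P_{(s_1,\dots,s_N)}$. -/

import Mathlib

open MeasureTheory
open scoped ComplexOrder InnerProductSpace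

noncomputable section

namespace QCorr

universe u v

/-! ### The Hilbert tensor product of a finite family of Hilbert spaces -/

section Tensor

set_option linter.unusedSectionVars false
set_option linter.unusedSimpArgs false

variable {ι : Type*} [Fintype ι]

/-- The algebraic tensor product `⨂ i, H i`, as a separate type that carries the tensor product
(semi-)inner product. -/
def AlgTensor (H : ι → Type u) [∀ i, NormedAddCommGroup (H i)]
    [∀ i, InnerProductSpace ℂ (H i)] : Type _ :=
  PiTensorProduct ℂ H

variable {H : ι → Type u} [∀ i, NormedAddCommGroup (H i)] [∀ i, InnerProductSpace ℂ (H i)]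

instance : AddCommGroup (AlgTensor H) := inferInstanceAs (AddCommGroup (PiTensorProduct ℂ H))

instance : Module ℂ (AlgTensor H) := inferInstanceAs (Module ℂ (PiTensorProduct ℂ H))

/-- The simple tensor `⨂ i, x i` in the algebraic tensor product. -/
def algTprod : MultilinearMap ℂ H (AlgTensor H) := PiTensorProduct.tprod ℂ

/-- The linear functional `⨂ i, y i ↦ ∏ i, ⟪x i, y i⟫`. -/
def bra (x : ∀ i, H i) : AlgTensor H →ₗ[ℂ] ℂ :=
  PiTensorProduct.lift
    ((MultilinearMap.mkPiAlgebra ℂ ι ℂ).compLinearMap fun i => innerₛₗ ℂ (x i))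

theorem bra_algTprod (x y : ∀ i, H i) : bra x (algTprod y) = ∏ i, ⟪x i, y i⟫_ℂ :=
  (PiTensorProduct.lift.tprod _).trans (by simp)

theorem algTensor_hom_ext {E : Type*} [AddCommGroup E] [Module ℂ E] {f g : AlgTensor H →ₗ[ℂ] E}
    (h : ∀ x, f (algTprod x) = g (algTprod x)) : f = g :=
  PiTensorProduct.ext (MultilinearMap.ext h)

/-- The functional `s ↦ conj ⟪s, t⟫` on the algebraic tensor product. -/
def coBra (t : AlgTensor H) : AlgTensor H →ₗ[ℂ] ℂ :=
  PiTensorProduct.lift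
    { toFun := fun x => (starRingEnd ℂ) (bra x t)
      map_update_add' := by
        intro _ x i a b
        have h : bra (Function.update x i (a + b)) =
            bra (Function.update x i a) + bra (Function.update x i b) := by
          refine algTensor_hom_ext fun y => ?_
          simp only [LinearMap.add_apply, bra_algTprod]
          rw [← Finset.mul_prod_erase _ _ (Finset.mem_univ i),
            ← Finset.mul_prod_erase _ _ (Finset.mem_univ i),
            ← Finset.mul_prod_erase _ _ (Finset.mem_univ i)]
          have e : ∀ c : H i, ∏ j ∈ Finset.univ.erase i, ⟪Function.update x i c j, y j⟫_ℂ =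
              ∏ j ∈ Finset.univ.erase i, ⟪x j, y j⟫_ℂ := fun c =>
            Finset.prod_congr rfl fun j hj => by
              rw [Function.update_of_ne (Finset.ne_of_mem_erase hj)]
          simp [e, inner_add_left, add_mul]
        simp [h]
      map_update_smul' := by
        intro _ x i c a
        have h : bra (Function.update x i (c • a)) =
            (starRingEnd ℂ) c • bra (Function.update x i a) := by
          refine algTensor_hom_ext fun y => ?_
          simp only [LinearMap.smul_apply, bra_algTprod]
          rw [← Finset.mul_prod_erase _ _ (Finset.mem_univ i),
            ← Finset.mul_prod_erase _ _ (Finset.mem_univ i)]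
          have e : ∀ c : H i, ∏ j ∈ Finset.univ.erase i, ⟪Function.update x i c j, y j⟫_ℂ =
              ∏ j ∈ Finset.univ.erase i, ⟪x j, y j⟫_ℂ := fun c =>
            Finset.prod_congr rfl fun j hj => by
              rw [Function.update_of_ne (Finset.ne_of_mem_erase hj)]
          simp [e, inner_smul_left]
          ring
        simp [h] }

theorem coBra_algTprod (t : AlgTensor H) (x : ∀ i, H i) :
    coBra t (algTprod x) = (starRingEnd ℂ) (bra x t) :=
  (PiTensorProduct.lift.tprod _).trans rfl

/-- The sesquilinear form on the algebraic tensor product that is determined by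
`⟪⨂ i, x i, ⨂ i, y i⟫ = ∏ i, ⟪x i, y i⟫`. -/
def tensorForm (s t : AlgTensor H) : ℂ := (starRingEnd ℂ) (coBra t s)

theorem exists_sum_algTprod (t : AlgTensor H) :
    ∃ c : (∀ i, H i) →₀ ℂ, t = c.sum fun x a => a • algTprod x := by
  have h : t ∈ Submodule.span ℂ (Set.range fun x => algTprod (H := H) x) :=
    (Submodule.eq_top_iff'.1 (PiTensorProduct.span_tprod_eq_top (R := ℂ) (s := H))) t
  obtain ⟨c, hc⟩ := Finsupp.mem_span_range_iff_exists_finsupp.1 h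
  exact ⟨c, hc.symm⟩

theorem tensorForm_sum (c d : (∀ i, H i) →₀ ℂ) :
    tensorForm (c.sum fun x a => a • algTprod x) (d.sum fun y b => b • algTprod y) =
      c.sum fun x a => d.sum fun y b => star a * (∏ i, ⟪x i, y i⟫_ℂ) * b := by
  simp only [tensorForm, Finsupp.sum, map_sum, map_smul, smul_eq_mul, map_mul, coBra_algTprod,
    bra_algTprod, Complex.conj_conj, Finset.mul_sum]
  refine Finset.sum_congr rfl fun x _ => Finset.sum_congr rfl fun y _ => ?_
  simp only [RCLike.star_def, mul_assoc]
  rw [mul_comm (d y)]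

/-! Positivity of the form, and the bound for tensor products of operators. -/

theorem gramKernel_posSemidef {X E : Type*} [NormedAddCommGroup E] [InnerProductSpace ℂ E]
    (f : X → E) : (Matrix.of fun x y : X => ⟪f x, f y⟫_ℂ).PosSemidef := by
  refine ⟨Matrix.ext fun x y => inner_conj_symm _ _, fun c => ?_⟩
  have h : (c.sum fun x a => c.sum fun y b =>
      star a * (Matrix.of fun x y : X => ⟪f x, f y⟫_ℂ) x y * b) =
      ⟪c.sum fun x a => a • f x, c.sum fun x a => a • f x⟫_ℂ := by
    simp only [Finsupp.sum, sum_inner, inner_smul_left]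
    simp only [inner_sum, inner_smul_right, Matrix.of_apply, RCLike.star_def, Finset.mul_sum]
    refine Finset.sum_congr rfl fun x _ => Finset.sum_congr rfl fun y _ => ?_
    ring
  rw [h, inner_self_eq_norm_sq_to_K]
  exact pow_nonneg (Complex.zero_le_real.2 (norm_nonneg (c.sum fun x a => a • f x))) 2

theorem boundKernel_posSemidef {X E : Type*} [NormedAddCommGroup E] [InnerProductSpace ℂ E]
    (A : E →L[ℂ] E) (f : X → E) :
    ((Matrix.of fun x y : X => ((‖A‖ : ℂ) ^ 2) * ⟪f x, f y⟫_ℂ) -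
      (Matrix.of fun x y : X => ⟪A (f x), A (f y)⟫_ℂ)).PosSemidef := by
  refine ⟨Matrix.ext fun x y => ?_, fun c => ?_⟩
  · simp [inner_conj_symm]
  have h : (c.sum fun x a => c.sum fun y b =>
      star a * ((Matrix.of fun x y : X => ((‖A‖ : ℂ) ^ 2) * ⟪f x, f y⟫_ℂ) -
      (Matrix.of fun x y : X => ⟪A (f x), A (f y)⟫_ℂ)) x y * b) =
      (‖A‖ : ℂ) ^ 2 * ⟪c.sum fun x a => a • f x, c.sum fun x a => a • f x⟫_ℂ -
      ⟪A (c.sum fun x a => a • f x), A (c.sum fun x a => a • f x)⟫_ℂ := by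
    simp only [Finsupp.sum, map_sum, map_smul, sum_inner, inner_smul_left]
    simp only [inner_sum, inner_smul_right, Matrix.of_apply, RCLike.star_def, Matrix.sub_apply,
      Finset.mul_sum]
    rw [← Finset.sum_sub_distrib]
    refine Finset.sum_congr rfl fun x _ => ?_
    rw [← Finset.sum_sub_distrib]
    refine Finset.sum_congr rfl fun y _ => ?_
    ring
  rw [h, inner_self_eq_norm_sq_to_K, inner_self_eq_norm_sq_to_K]
  have h2 := A.le_opNorm (c.sum fun x a => a • f x)
  have h3 : ‖A (c.sum fun x a => a • f x)‖ ^ 2 ≤ ‖A‖ ^ 2 * ‖c.sum fun x a => a • f x‖ ^ 2 := by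
    rw [← mul_pow]
    exact pow_le_pow_left₀ (norm_nonneg _) h2 2
  rw [sub_nonneg]
  have h4 := Complex.real_le_real.2 h3
  push_cast at h4
  exact h4

theorem prodKernel_posSemidef {X : Type*} (s : Finset ι) (f : ∀ i, X → H i) :
    (Matrix.of fun x y : X => ∏ i ∈ s, ⟪f i x, f i y⟫_ℂ).PosSemidef := by
  classical
  induction s using Finset.induction_on with
  | empty =>
    simpa using gramKernel_posSemidef (fun _ : X => (1 : ℂ))
  | insert i s hi ih =>
    have e : (Matrix.of fun x y : X => ∏ i ∈ insert i s, ⟪f i x, f i y⟫_ℂ) =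
        Matrix.hadamard (Matrix.of fun x y : X => ⟪f i x, f i y⟫_ℂ)
          (Matrix.of fun x y : X => ∏ i ∈ s, ⟪f i x, f i y⟫_ℂ) := by
      ext x y
      simp [Finset.prod_insert hi]
    rw [e]
    exact Matrix.PosSemidef.hadamard (gramKernel_posSemidef (f i)) ih

theorem prodBoundKernel_posSemidef {X : Type*} (s : Finset ι) (A : ∀ i, H i →L[ℂ] H i)
    (f : ∀ i, X → H i) :
    ((Matrix.of fun x y : X => ∏ i ∈ s, (((‖A i‖ : ℂ) ^ 2) * ⟪f i x, f i y⟫_ℂ)) -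
      (Matrix.of fun x y : X => ∏ i ∈ s, ⟪A i (f i x), A i (f i y)⟫_ℂ)).PosSemidef := by
  classical
  induction s using Finset.induction_on with
  | empty =>
    simpa using Matrix.PosSemidef.zero
  | insert i s hi ih =>
    have h0 : (0 : ℂ) ≤ (‖A i‖ : ℂ) ^ 2 := pow_nonneg (Complex.zero_le_real.2 (norm_nonneg _)) 2
    have h1 := Matrix.PosSemidef.hadamard ((gramKernel_posSemidef (f i)).smul h0) ih
    have h2 := Matrix.PosSemidef.hadamard (boundKernel_posSemidef (A i) (f i))
      (prodKernel_posSemidef s fun j x => A j (f j x))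
    have e : ((Matrix.of fun x y : X => ∏ i ∈ insert i s, (((‖A i‖ : ℂ) ^ 2) * ⟪f i x, f i y⟫_ℂ)) -
        (Matrix.of fun x y : X => ∏ i ∈ insert i s, ⟪A i (f i x), A i (f i y)⟫_ℂ)) =
        Matrix.hadamard (((‖A i‖ : ℂ) ^ 2) • Matrix.of fun x y : X => ⟪f i x, f i y⟫_ℂ)
          ((Matrix.of fun x y : X => ∏ i ∈ s, (((‖A i‖ : ℂ) ^ 2) * ⟪f i x, f i y⟫_ℂ)) -
            (Matrix.of fun x y : X => ∏ i ∈ s, ⟪A i (f i x), A i (f i y)⟫_ℂ)) +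
        Matrix.hadamard ((Matrix.of fun x y : X => ((‖A i‖ : ℂ) ^ 2) * ⟪f i x, f i y⟫_ℂ) -
            (Matrix.of fun x y : X => ⟪A i (f i x), A i (f i y)⟫_ℂ))
          (Matrix.of fun x y : X => ∏ i ∈ s, ⟪A i (f i x), A i (f i y)⟫_ℂ) := by
      ext x y
      simp only [Matrix.sub_apply, Matrix.of_apply, Finset.prod_insert hi, Matrix.add_apply,
        Matrix.hadamard_apply, Matrix.smul_apply, smul_eq_mul]
      ring
    rw [e]
    exact Matrix.PosSemidef.add h1 h2

instance : PreInnerProductSpace.Core ℂ (AlgTensor H) where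
  inner := tensorForm
  conj_inner_symm s t := by
    obtain ⟨c, rfl⟩ := exists_sum_algTprod s
    obtain ⟨d, rfl⟩ := exists_sum_algTprod t
    rw [tensorForm_sum, tensorForm_sum, Finsupp.sum_comm]
    simp only [Finsupp.sum, map_sum, map_mul, map_prod, inner_conj_symm, RCLike.star_def,
      Complex.conj_conj]
    refine Finset.sum_congr rfl fun x _ => Finset.sum_congr rfl fun y _ => ?_
    ring
  re_inner_nonneg t := by
    obtain ⟨c, rfl⟩ := exists_sum_algTprod t
    have h := (prodKernel_posSemidef Finset.univ fun i (x : ∀ i, H i) => x i).2 c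
    rw [tensorForm_sum]
    exact (Complex.le_def.1 h).1
  add_left r s t := by simp [tensorForm]
  smul_left s t c := by simp [tensorForm]

instance : SeminormedAddCommGroup (AlgTensor H) :=
  InnerProductSpace.Core.toSeminormedAddCommGroup (𝕜 := ℂ)

instance : InnerProductSpace ℂ (AlgTensor H) := InnerProductSpace.ofCore _

theorem algTensor_inner_def (s t : AlgTensor H) : ⟪s, t⟫_ℂ = tensorForm s t := rfl

variable (H) in
/-- The Hilbert tensor product `⨂ i, H i` of a finite family: the completion of the algebraic tensor
product with respect to the inner product `⟪⨂ i, x i, ⨂ i, y i⟫ = ∏ i, ⟪x i, y i⟫`. -/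
abbrev HilbertTensor : Type _ := UniformSpace.Completion (AlgTensor H)

/-- The simple tensor `⨂ i, x i` in the Hilbert tensor product. -/
def simpleTensor (x : ∀ i, H i) : HilbertTensor H := ((algTprod x : AlgTensor H) : HilbertTensor H)

theorem inner_simpleTensor (x y : ∀ i, H i) :
    ⟪simpleTensor x, simpleTensor y⟫_ℂ = ∏ i, ⟪x i, y i⟫_ℂ := by
  simp [simpleTensor, algTensor_inner_def, tensorForm, coBra_algTprod, bra_algTprod]

/-- The algebraic tensor product of operators. -/
def algTensorMap (A : ∀ i, H i →L[ℂ] H i) : AlgTensor H →ₗ[ℂ] AlgTensor H :=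
  PiTensorProduct.map fun i => (A i : H i →ₗ[ℂ] H i)

theorem algTensorMap_algTprod (A : ∀ i, H i →L[ℂ] H i) (x : ∀ i, H i) :
    algTensorMap A (algTprod x) = algTprod fun i => A i (x i) :=
  PiTensorProduct.map_tprod _ _

theorem norm_algTensorMap_le (A : ∀ i, H i →L[ℂ] H i) (t : AlgTensor H) :
    ‖algTensorMap A t‖ ≤ (∏ i, ‖A i‖) * ‖t‖ := by
  have key : ‖algTensorMap A t‖ ^ 2 ≤ ((∏ i, ‖A i‖) * ‖t‖) ^ 2 := by
    rw [mul_pow, ← @inner_self_eq_norm_sq ℂ, ← @inner_self_eq_norm_sq ℂ]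
    obtain ⟨c, rfl⟩ := exists_sum_algTprod t
    have h := (prodBoundKernel_posSemidef Finset.univ A fun i (x : ∀ i, H i) => x i).2 c
    have e1 : ⟪algTensorMap A (c.sum fun x a => a • algTprod x),
        algTensorMap A (c.sum fun x a => a • algTprod x)⟫_ℂ =
        c.sum fun x a => c.sum fun y b => star a * (∏ i, ⟪A i (x i), A i (y i)⟫_ℂ) * b := by
      simp only [Finsupp.sum, map_sum, map_smul, algTensorMap_algTprod, sum_inner,
        inner_smul_left]
      simp only [inner_sum, inner_smul_right, algTensor_inner_def, tensorForm, coBra_algTprod,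
        bra_algTprod, Complex.conj_conj, RCLike.star_def, Finset.mul_sum]
      refine Finset.sum_congr rfl fun x _ => Finset.sum_congr rfl fun y _ => ?_
      ring
    have e2 : (c.sum fun x a => c.sum fun y b => star a *
        ((Matrix.of fun x y : (∀ i, H i) => ∏ i, (((‖A i‖ : ℂ) ^ 2) * ⟪x i, y i⟫_ℂ)) -
          (Matrix.of fun x y : (∀ i, H i) => ∏ i, ⟪A i (x i), A i (y i)⟫_ℂ)) x y * b) =
        (((∏ i, ‖A i‖) ^ 2 : ℝ) : ℂ) * ⟪c.sum fun x a => a • algTprod x,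
          c.sum fun x a => a • algTprod x⟫_ℂ -
        ⟪algTensorMap A (c.sum fun x a => a • algTprod x),
          algTensorMap A (c.sum fun x a => a • algTprod x)⟫_ℂ := by
      rw [e1, algTensor_inner_def, tensorForm_sum]
      simp only [Finsupp.sum, Finset.mul_sum, ← Finset.sum_sub_distrib, Matrix.sub_apply,
        Matrix.of_apply, Finset.prod_mul_distrib, Finset.prod_pow, Complex.ofReal_pow,
        Complex.ofReal_prod]
      refine Finset.sum_congr rfl fun x _ => Finset.sum_congr rfl fun y _ => ?_
      ring
    rw [e2] at h
    have h' := (Complex.le_def.1 h).1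
    rw [Complex.sub_re, Complex.re_ofReal_mul] at h'
    simpa using h'
  exact (sq_le_sq₀ (norm_nonneg _)
    (mul_nonneg (Finset.prod_nonneg fun i _ => norm_nonneg _) (norm_nonneg _))).1 key

variable (H) in
/-- The embedding of the algebraic tensor product. -/
def toHilbertTensor : AlgTensor H →ₗ[ℂ] HilbertTensor H :=
  (UniformSpace.Completion.toComplₗᵢ (𝕜 := ℂ) (E := AlgTensor H)).toLinearMap

theorem denseRange_toHilbertTensor : DenseRange (toHilbertTensor H) :=
  UniformSpace.Completion.denseRange_coe

/-- The tensor product `⨂ i, A i` of bounded operators: the bounded operator on the Hilbert tensor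
product with `(⨂ i, A i) (⨂ i, x i) = ⨂ i, A i (x i)`. -/
def tensorMap (A : ∀ i, H i →L[ℂ] H i) : HilbertTensor H →L[ℂ] HilbertTensor H :=
  (toHilbertTensor H ∘ₗ algTensorMap A).extendOfNorm (toHilbertTensor H)

theorem tensorMap_coe (A : ∀ i, H i →L[ℂ] H i) (t : AlgTensor H) :
    tensorMap A (t : HilbertTensor H) = (algTensorMap A t : AlgTensor H) :=
  LinearMap.extendOfNorm_eq (e := toHilbertTensor H) denseRange_toHilbertTensor
    ⟨∏ i, ‖A i‖, fun s => by
      simpa [toHilbertTensor] using norm_algTensorMap_le A s⟩ t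

theorem tensorMap_simpleTensor (A : ∀ i, H i →L[ℂ] H i) (x : ∀ i, H i) :
    tensorMap A (simpleTensor x) = simpleTensor fun i => A i (x i) := by
  rw [simpleTensor, tensorMap_coe, algTensorMap_algTprod, simpleTensor]

end Tensor

/-! ### Trace class operators, the trace, states -/

section Trace

variable (K : Type*) [NormedAddCommGroup K] [InnerProductSpace ℂ K] [CompleteSpace K]

/-- Index set of a fixed orthonormal basis of the Hilbert space `K`. -/
def basisIndex : Set K := (exists_hilbertBasis ℂ K).choose

/-- A fixed orthonormal basis of the Hilbert space `K`. -/
def onb : HilbertBasis (basisIndex K) ℂ K := (exists_hilbertBasis ℂ K).choose_spec.choose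

variable {K}

/-- `T` is a trace class operator: `tr |T| < ∞`, where `|T| = √(T* T)`. -/
def IsTraceClass (T : K →L[ℂ] K) : Prop :=
  Summable fun i => (⟪onb K i, CFC.abs T (onb K i)⟫_ℂ).re

/-- The trace of a trace class operator. -/
def trace (T : K →L[ℂ] K) : ℂ := ∑' i, ⟪onb K i, T (onb K i)⟫_ℂ

/-- Quantum states (density operators): positive trace class operators with trace one. -/
structure IsState (ρ : K →L[ℂ] K) : Prop where
  pos : ρ.IsPositive
  traceClass : IsTraceClass ρ
  trace_eq_one : trace ρ = 1

end Trace

/-- A normalized positive operator-valued measure on the measurable space `Λ` with values in the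
bounded operators on `H`; it is countably additive in the weak operator topology. -/
structure POVM (Λ : Type v) [MeasurableSpace Λ] (H : Type u) [NormedAddCommGroup H]
    [InnerProductSpace ℂ H] where
  /-- The operator `M(F)`. -/
  toFun : Set Λ → H →L[ℂ] H
  isPositive : ∀ F, MeasurableSet F → (toFun F).IsPositive
  univ_eq_one : toFun Set.univ = 1
  hasSum_iUnion : ∀ F : ℕ → Set Λ, (∀ i, MeasurableSet (F i)) →
    Pairwise (Function.onFun Disjoint F) → ∀ x y : H,
      HasSum (fun i => ⟪x, toFun (F i) y⟫_ℂ) ⟪x, toFun (⋃ i, F i) y⟫_ℂ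

/-! ### Signed measures and local quasi hidden variable models -/

/-- A real-valued measure `ν` is normalized and bounded: `ν(Ω) = 1` and `|ν(F)| ≤ C < ∞` for all
events `F`. -/
def IsNormalizedBounded {Ω : Type*} [MeasurableSpace Ω] (ν : SignedMeasure Ω) : Prop :=
  ν Set.univ = 1 ∧ ∃ C : ℝ, ∀ F, MeasurableSet F → |ν F| ≤ C

section Scenario

variable {N : ℕ} {S : Fin N → ℕ} {Λ : Fin N → Type v} [∀ n, MeasurableSpace (Λ n)]

/-- The correlation scenario with joint probability distributions `P s` on `Λ 1 × ⋯ × Λ N`,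
`s = (s 1, …, s N)`, admits a local quasi hidden variable model: there are a measure space
`(Ω, ν)` with a normalized bounded real-valued measure `ν` and conditional probability measures
`Q n j ω`, defined `ν`-almost everywhere and with `ω ↦ Q n j ω F` measurable, such that
`P s (F 1 × ⋯ × F N) = ∫ Q 1 (s 1) ω (F 1) ⋯ Q N (s N) ω (F N) ν(dω)`. -/
def AdmitsLqHV (P : (∀ n, Fin (S n)) → Measure (∀ n, Λ n)) : Prop :=
  ∃ (Ω : Type v) (_ : MeasurableSpace Ω) (ν : SignedMeasure Ω)
    (Q : ∀ n, Fin (S n) → Ω → Measure (Λ n)),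
    IsNormalizedBounded ν ∧
    (∀ n j, ∀ᵐ ω ∂ν.totalVariation, IsProbabilityMeasure (Q n j ω)) ∧
    (∀ n j F, MeasurableSet F → Measurable fun ω => Q n j ω F) ∧
    ∀ (s : ∀ n, Fin (S n)) (F : ∀ n, Set (Λ n)), (∀ n, MeasurableSet (F n)) →
      (P s).real (Set.univ.pi F) = ∫ᵛ ω, ∏ n, (Q n (s n) ω).real (F n) ∂<•ν

variable {H : Fin N → Type u} [∀ n, NormedAddCommGroup (H n)] [∀ n, InnerProductSpace ℂ (H n)]

/-- `P` is the family of joint probability distributions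
`P s (dλ 1 × ⋯ × dλ N) = tr[ρ {M 1 (s 1) (dλ 1) ⊗ ⋯ ⊗ M N (s N) (dλ N)}]` of the quantum correlation
scenario given by the state `ρ` and the POV measures `M n j`, `j = 1, …, S n`. -/
structure IsQuantumScenario (ρ : HilbertTensor H →L[ℂ] HilbertTensor H)
    (M : ∀ n, Fin (S n) → POVM (Λ n) (H n))
    (P : (∀ n, Fin (S n)) → Measure (∀ n, Λ n)) : Prop where
  isProbabilityMeasure : ∀ s, IsProbabilityMeasure (P s)
  apply_pi : ∀ (s : ∀ n, Fin (S n)) (F : ∀ n, Set (Λ n)), (∀ n, MeasurableSet (F n)) →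
    (((P s).real (Set.univ.pi F) : ℝ) : ℂ) =
      trace (ρ * tensorMap fun n => (M n (s n)).toFun (F n))

/-- The Hilbert space `H 1 ^⊗(S 1) ⊗ ⋯ ⊗ H N ^⊗(S N)`; its tensor factors are labelled by the pairs
`(n, j)` with `j` one of the `S n` copies of `H n`. -/
abbrev SourceSpace (S : Fin N → ℕ) (H : Fin N → Type u) [∀ n, NormedAddCommGroup (H n)]
    [∀ n, InnerProductSpace ℂ (H n)] : Type _ :=
  HilbertTensor fun p : Σ n, Fin (S n) => H p.1

/-- `T` is an `S 1 × ⋯ × S N`-setting source operator for `ρ`: a self-adjoint trace class operator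
on `H 1 ^⊗(S 1) ⊗ ⋯ ⊗ H N ^⊗(S N)` such that, for all bounded operators `X n` on `H n` and every
choice of one copy `k n` at each site, `tr[T {⋯}] = tr[ρ {X 1 ⊗ ⋯ ⊗ X N}]`, where `{⋯}` has `X n` on
the copy `k n` of `H n` and the identity on all other copies. -/
structure IsSourceOperator (ρ : HilbertTensor H →L[ℂ] HilbertTensor H)
    (T : SourceSpace S H →L[ℂ] SourceSpace S H) : Prop where
  isSelfAdjoint : IsSelfAdjoint T
  traceClass : IsTraceClass T
  trace_eq : ∀ (k : ∀ n, Fin (S n)) (X : ∀ n, H n →L[ℂ] H n),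
    trace (T * tensorMap fun p : Σ n, Fin (S n) => if p.2 = k p.1 then X p.1 else 1) =
      trace (ρ * tensorMap X)

/-- `μ` is the measure `tr[T {⨂ n, ⨂ j, M n j (dλ n j)}]` on `Λ 1 ^(S 1) × ⋯ × Λ N ^(S N)`, i.e. the
real-valued measure with these values on the measurable rectangles. -/
def IsSourceMeasure (T : SourceSpace S H →L[ℂ] SourceSpace S H)
    (M : ∀ n, Fin (S n) → POVM (Λ n) (H n))
    (μ : SignedMeasure (∀ n, Fin (S n) → Λ n)) : Prop :=
  ∀ F : ∀ n, Fin (S n) → Set (Λ n), (∀ n j, MeasurableSet (F n j)) →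
    ((μ {l | ∀ n j, l n j ∈ F n j} : ℝ) : ℂ) =
      trace (T * tensorMap fun p : Σ n, Fin (S n) => (M p.1 p.2).toFun (F p.1 p.2))

end Scenario

end QCorr

end

/-! The functionals `tr(ρ ·)` and `tr(T ·)` are normal: norm limits of linear combinations of `Y ↦
⟪u, Y v⟫`. The joint distributions, the signed measures and the source operator then come from two
facts about normal functionals `φ` on the bounded operators of a Hilbert tensor product.

Measures. Every normal `φ` has a complex measure `ν` with `ν (∏ F i) = φ (⨂ M i (F i))`
(`exists_isProductMeasure`). For vector functionals at simple tensors the right side factorizes, and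
polarization yields a combination of product measures. The functionals that have such a measure form
a subspace, and it is norm closed because `‖ν E‖ ≤ ‖φ‖` for every event `E`
(`IsProductMeasure.norm_le`). Indeed, on a finite union of rectangles `ν` is the value of `φ` at a
positive operator, which adds up to `1` with the operator of the complement and so is a contraction;
general events are approximated by such unions. Countable additivity is thus inherited through
uniform limits. Positive `φ` give positive measures, hermitian `φ` real ones.

Source operators. Fix unit vectors `e n`. At a site with `s` copies, either put that factor of `ρ`
on copy `j` and `e n` on the others, or trace the factor out and put `e n` on all copies. Add the
`s` placements and `1 - s` times the last variant. If `X` is measured on copy `k`, the placement `j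
= k` gives the wanted value, while the `s - 1` other placements give the same value as the
traced-out variant and cancel against it. Doing this at all sites produces a hermitian normal
functional (`exists_isSourceOperator`), which is the trace against a self-adjoint trace class
operator (`trace_densityOperator_mul`, `isTraceClass_densityOperator`).

Conclusion. The measure of a source operator has the scenario as marginals, since `M(Λ) = 1` turns
every unobserved copy into an identity (`IsSourceMeasure.marginal_eq`). Such a signed measure is
itself an LqHV model: the hidden variable is the tuple of all outcomes, and the conditional measures
are Dirac measures. -/

noncomputable section

namespace QCorr

open Filter Topology InnerProductSpace

/-! ### Normal functionals on the bounded operators -/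

section Normal

variable {K : Type*} [NormedAddCommGroup K] [InnerProductSpace ℂ K]

/-- The vector functional `Y ↦ ⟪u, Y v⟫`. -/
def vecFunctional (u v : K) : (K →L[ℂ] K) →L[ℂ] ℂ :=
  innerSL ℂ u ∘L ContinuousLinearMap.apply ℂ K v

@[simp]
theorem vecFunctional_apply (u v : K) (Y : K →L[ℂ] K) : vecFunctional u v Y = ⟪u, Y v⟫_ℂ := rfl

theorem norm_vecFunctional_le (u v : K) : ‖vecFunctional u v‖ ≤ ‖u‖ * ‖v‖ := by
  refine ContinuousLinearMap.opNorm_le_bound _ (by positivity) fun Y => ?_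
  calc ‖⟪u, Y v⟫_ℂ‖ ≤ ‖u‖ * ‖Y v‖ := norm_inner_le_norm _ _
    _ ≤ ‖u‖ * (‖Y‖ * ‖v‖) := by gcongr; exact Y.le_opNorm v
    _ = ‖u‖ * ‖v‖ * ‖Y‖ := by ring

variable (K) in
/-- The normal functionals: the norm closed span of the vector functionals. -/
def normalFunctionals : Submodule ℂ ((K →L[ℂ] K) →L[ℂ] ℂ) :=
  (Submodule.span ℂ (Set.range fun p : K × K => vecFunctional p.1 p.2)).topologicalClosure

theorem isClosed_normalFunctionals :
    IsClosed (normalFunctionals K : Set ((K →L[ℂ] K) →L[ℂ] ℂ)) :=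
  Submodule.isClosed_topologicalClosure _

theorem vecFunctional_mem (u v : K) : vecFunctional u v ∈ normalFunctionals K :=
  Submodule.le_topologicalClosure _ (Submodule.subset_span ⟨(u, v), rfl⟩)

theorem normalFunctionals_le {C : Submodule ℂ ((K →L[ℂ] K) →L[ℂ] ℂ)}
    (hC : IsClosed (C : Set ((K →L[ℂ] K) →L[ℂ] ℂ))) (h : ∀ u v, vecFunctional u v ∈ C) :
    normalFunctionals K ≤ C :=
  Submodule.topologicalClosure_minimal _
    (Submodule.span_le.2 (by rintro _ ⟨p, rfl⟩; exact h p.1 p.2)) hC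

variable [CompleteSpace K]

/-- The orthogonal projection onto the span of finitely many vectors of the fixed basis. -/
def basisProj (F : Finset (basisIndex K)) : K →L[ℂ] K :=
  ∑ i ∈ F, rankOne ℂ (onb K i) (onb K i)

theorem basisProj_apply (F : Finset (basisIndex K)) (x : K) :
    basisProj F x = ∑ i ∈ F, ⟪onb K i, x⟫_ℂ • onb K i := by
  simp [basisProj]

theorem tendsto_basisProj (x : K) : Tendsto (fun F => basisProj F x) atTop (𝓝 x) := by
  have h := (onb K).hasSum_repr x
  simp only [HilbertBasis.repr_apply_apply] at h
  simpa only [HasSum, SummationFilter.unconditional_filter, ← basisProj_apply] using h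

theorem norm_basisProj_apply_sq (F : Finset (basisIndex K)) (x : K) :
    ‖basisProj F x‖ ^ 2 = ∑ i ∈ F, ‖⟪onb K i, x⟫_ℂ‖ ^ 2 := by
  rw [basisProj_apply, ← @inner_self_eq_norm_sq ℂ, (onb K).orthonormal.inner_sum]
  have h : ∑ i ∈ F, (starRingEnd ℂ) ⟪onb K i, x⟫_ℂ * ⟪onb K i, x⟫_ℂ =
      ((∑ i ∈ F, ‖⟪onb K i, x⟫_ℂ‖ ^ 2 : ℝ) : ℂ) := by
    push_cast
    exact Finset.sum_congr rfl fun i _ => RCLike.conj_mul _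
  rw [h]
  exact Complex.ofReal_re _

theorem norm_basisProj_apply_le (F : Finset (basisIndex K)) (x : K) :
    ‖basisProj F x‖ ≤ ‖x‖ := by
  refine le_of_sq_le_sq ?_ (norm_nonneg _)
  rw [norm_basisProj_apply_sq]
  exact (onb K).orthonormal.sum_inner_products_le x

theorem norm_basisProj_le (F : Finset (basisIndex K)) : ‖basisProj F‖ ≤ 1 :=
  ContinuousLinearMap.opNorm_le_bound _ zero_le_one fun x => by
    simpa using norm_basisProj_apply_le F x

/-- The projections converge only strongly. Vector functionals see this convergence, and the bound
`‖Y P Z‖ ≤ ‖Y‖ ‖Z‖`, uniform in the projection `P`, carries it over to norm limits of their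
combinations. -/
theorem tendsto_normal {φ : (K →L[ℂ] K) →L[ℂ] ℂ} (hφ : φ ∈ normalFunctionals K)
    (Y Z : K →L[ℂ] K) :
    Tendsto (fun F => φ (Y * basisProj F * Z)) atTop (𝓝 (φ (Y * Z))) := by
  let C : Submodule ℂ ((K →L[ℂ] K) →L[ℂ] ℂ) :=
    { carrier := {φ | Tendsto (fun F => φ (Y * basisProj F * Z)) atTop (𝓝 (φ (Y * Z)))}
      add_mem' := fun h₁ h₂ => by simpa using Tendsto.add h₁ h₂
      zero_mem' := by simp
      smul_mem' := fun c _ h => by simpa using Tendsto.const_mul c h }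
  refine normalFunctionals_le (C := C) ?_ ?_ hφ
  · refine isClosed_of_closure_subset fun φ hφ => ?_
    classical
    refine Metric.tendsto_atTop.2 fun ε hε => ?_
    -- The summand `1` keeps the denominator positive when `Y` or `Z` vanishes.
    obtain ⟨ψ, hψ, hd⟩ := Metric.mem_closure_iff.1 hφ (ε / (3 * (‖Y‖ * ‖Z‖ + 1)))
      (by positivity)
    obtain ⟨F₀, hF⟩ := Metric.tendsto_atTop.1 (show Tendsto _ _ _ from hψ) (ε / 3) (by positivity)
    refine ⟨F₀, fun F hFF => ?_⟩
    have key : ∀ W : K →L[ℂ] K, ‖W‖ ≤ ‖Y‖ * ‖Z‖ → dist (φ W) (ψ W) ≤ ε / 3 := by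
      intro W hW
      rw [dist_eq_norm, ← sub_apply]
      calc ‖(φ - ψ) W‖ ≤ ‖φ - ψ‖ * ‖W‖ := ContinuousLinearMap.le_opNorm _ _
        _ ≤ (ε / (3 * (‖Y‖ * ‖Z‖ + 1))) * (‖Y‖ * ‖Z‖ + 1) := by
          rw [dist_eq_norm] at hd
          gcongr
          linarith
        _ = ε / 3 := by field_simp
    have h1 := key (Y * basisProj F * Z) (by
      calc ‖Y * basisProj F * Z‖ ≤ ‖Y‖ * ‖basisProj F‖ * ‖Z‖ :=
            (norm_mul_le _ _).trans (by gcongr; exact norm_mul_le _ _)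
        _ ≤ ‖Y‖ * 1 * ‖Z‖ := by gcongr; exact norm_basisProj_le F
        _ = ‖Y‖ * ‖Z‖ := by ring)
    have h2 := key (Y * Z) (norm_mul_le _ _)
    have h3 := hF F hFF
    have h4 := dist_triangle4 (φ (Y * basisProj F * Z)) (ψ (Y * basisProj F * Z)) (ψ (Y * Z))
      (φ (Y * Z))
    rw [dist_comm (ψ (Y * Z)) (φ (Y * Z))] at h4
    linarith
  · intro u v
    have h := (((innerSL ℂ u) ∘L Y).continuous.tendsto _).comp (tendsto_basisProj (Z v))
    exact h

theorem mul_basisProj_mul (Y Z : K →L[ℂ] K) (F : Finset (basisIndex K)) :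
    Y * basisProj F * Z =
      ∑ i ∈ F, rankOne ℂ (Y (onb K i)) (Z.adjoint (onb K i)) := by
  ext x
  simp [basisProj_apply, ContinuousLinearMap.adjoint_inner_left]

/-- A normal functional is the sum of its values on rank one operators. -/
theorem hasSum_normal {φ : (K →L[ℂ] K) →L[ℂ] ℂ} (hφ : φ ∈ normalFunctionals K)
    (Y Z : K →L[ℂ] K) :
    HasSum (fun i => φ (rankOne ℂ (Y (onb K i)) (Z.adjoint (onb K i)))) (φ (Y * Z)) := by
  have h := tendsto_normal hφ Y Z
  simp only [mul_basisProj_mul, map_sum] at h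
  simpa only [HasSum, SummationFilter.unconditional_filter] using h

end Normal

/-! ### Trace class operators and normal functionals -/

section TraceClass

variable {K : Type*} [NormedAddCommGroup K] [InnerProductSpace ℂ K] [CompleteSpace K]

theorem hasSum_norm_inner_sq (x : K) : HasSum (fun i => ‖⟪x, onb K i⟫_ℂ‖ ^ 2) (‖x‖ ^ 2) := by
  have h := (onb K).hasSum_inner_mul_inner x x
  rw [inner_self_eq_norm_sq_to_K] at h
  have e : (fun i => ⟪x, onb K i⟫_ℂ * ⟪onb K i, x⟫_ℂ) =
      fun i => ((‖⟪x, onb K i⟫_ℂ‖ ^ 2 : ℝ) : ℂ) := by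
    ext i
    rw [← inner_conj_symm (onb K i) x]
    push_cast
    exact RCLike.mul_conj _
  rw [e] at h
  refine Complex.hasSum_ofReal.1 ?_
  rw [Complex.ofReal_pow]
  exact h

/-- This is the Hilbert–Schmidt estimate for `C Y`: expand each `‖C Y e_i‖²` by Parseval, sum over
`i` first, and apply Bessel to `Y* C e_j`. -/
theorem sum_norm_sq_mul_le {C : K →L[ℂ] K} (hC : IsSelfAdjoint C)
    (hs : Summable fun i => ‖C (onb K i)‖ ^ 2) (Y : K →L[ℂ] K) (F : Finset (basisIndex K)) :
    ∑ i ∈ F, ‖C (Y (onb K i))‖ ^ 2 ≤ ‖Y‖ ^ 2 * ∑' i, ‖C (onb K i)‖ ^ 2 := by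
  have h1 : ∀ i, HasSum (fun j => ‖⟪C (Y (onb K i)), onb K j⟫_ℂ‖ ^ 2) (‖C (Y (onb K i))‖ ^ 2) :=
    fun i => hasSum_norm_inner_sq _
  have h2 := hasSum_sum (s := F) fun i _ => h1 i
  rw [← tsum_mul_left]
  refine hasSum_le (fun j => ?_) h2 (hs.mul_left _).hasSum
  have h3 : ∀ i, ‖⟪C (Y (onb K i)), onb K j⟫_ℂ‖ = ‖⟪onb K i, Y.adjoint (C (onb K j))⟫_ℂ‖ := by
    intro i
    rw [ContinuousLinearMap.adjoint_inner_right, ← ContinuousLinearMap.adjoint_inner_right C,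
      hC.adjoint_eq]
  simp only [h3]
  calc _ ≤ ‖Y.adjoint (C (onb K j))‖ ^ 2 := (onb K).orthonormal.sum_inner_products_le _
    _ ≤ (‖Y.adjoint‖ * ‖C (onb K j)‖) ^ 2 := by
      gcongr
      exact ContinuousLinearMap.le_opNorm _ _
    _ = _ := by rw [mul_pow, LinearIsometryEquiv.norm_map]

/-- For a Hilbert–Schmidt `C` the series of vector functionals `Y ↦ ⟪C e_i, C Y e_i⟫` converges in
norm: by Cauchy–Schwarz a block of it is bounded by a block of `∑ ‖C e_i‖²`, up to a constant,
because the second factor is controlled by `‖Y‖`. -/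
theorem exists_normal_of_sq {C : K →L[ℂ] K} (hC : IsSelfAdjoint C)
    (hs : Summable fun i => ‖C (onb K i)‖ ^ 2) :
    ∃ φ ∈ normalFunctionals K, ∀ Y : K →L[ℂ] K,
      HasSum (fun i => ⟪onb K i, C (C (Y (onb K i)))⟫_ℂ) (φ Y) := by
  let f : basisIndex K → ((K →L[ℂ] K) →L[ℂ] ℂ) := fun i => vecFunctional (C (C (onb K i))) (onb K i)
  have hf : ∀ i Y, f i Y = ⟪C (onb K i), C (Y (onb K i))⟫_ℂ := fun i Y => by
    simp only [f, vecFunctional_apply]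
    rw [← ContinuousLinearMap.adjoint_inner_right C, hC.adjoint_eq]
  set A := ∑' i, ‖C (onb K i)‖ ^ 2 with hA
  have hA0 : 0 ≤ A := tsum_nonneg fun i => by positivity
  have hbound : ∀ F : Finset (basisIndex K), ‖∑ i ∈ F, f i‖ ≤
      √(∑ i ∈ F, ‖C (onb K i)‖ ^ 2) * √A := by
    intro F
    refine ContinuousLinearMap.opNorm_le_bound _ (by positivity) fun Y => ?_
    rw [sum_apply]
    calc ‖∑ i ∈ F, f i Y‖ ≤ ∑ i ∈ F, ‖C (onb K i)‖ * ‖C (Y (onb K i))‖ := by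
          refine (norm_sum_le _ _).trans (Finset.sum_le_sum fun i _ => ?_)
          rw [hf]
          exact norm_inner_le_norm _ _
      _ ≤ √(∑ i ∈ F, ‖C (onb K i)‖ ^ 2) * √(∑ i ∈ F, ‖C (Y (onb K i))‖ ^ 2) :=
          Real.sum_mul_le_sqrt_mul_sqrt _ _ _
      _ ≤ √(∑ i ∈ F, ‖C (onb K i)‖ ^ 2) * √(‖Y‖ ^ 2 * A) := by
          gcongr
          exact sum_norm_sq_mul_le hC hs Y F
      _ = _ := by
          rw [Real.sqrt_mul (by positivity), Real.sqrt_sq (norm_nonneg _)]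
          ring
  have hsum : Summable f := by
    rw [summable_iff_vanishing_norm]
    intro ε hε
    obtain ⟨s, h⟩ := summable_iff_vanishing_norm.1 hs ((ε / (√A + 1)) ^ 2) (by positivity)
    refine ⟨s, fun t ht => (hbound t).trans_lt ?_⟩
    have h1 := h t ht
    rw [Real.norm_of_nonneg (Finset.sum_nonneg fun i _ => by positivity)] at h1
    have h2 : √(∑ i ∈ t, ‖C (onb K i)‖ ^ 2) < ε / (√A + 1) := by
      rw [Real.sqrt_lt' (by positivity)]
      exact h1
    calc _ ≤ √(∑ i ∈ t, ‖C (onb K i)‖ ^ 2) * (√A + 1) := by gcongr; linarith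
      _ < ε / (√A + 1) * (√A + 1) := by gcongr
      _ = ε := by field_simp
  refine ⟨∑' i, f i, ?_, fun Y => ?_⟩
  · refine isClosed_normalFunctionals.mem_of_tendsto hsum.hasSum (Eventually.of_forall fun F => ?_)
    exact Submodule.sum_mem _ fun i _ => vecFunctional_mem _ _
  · have h := hsum.hasSum.mapL (ContinuousLinearMap.apply ℂ ℂ Y)
    simp only [ContinuousLinearMap.apply_apply, hf] at h
    have e : ∀ i, ⟪C (onb K i), C (Y (onb K i))⟫_ℂ = ⟪onb K i, C (C (Y (onb K i)))⟫_ℂ := fun i => by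
      rw [← ContinuousLinearMap.adjoint_inner_left C (C _), hC.adjoint_eq]
    simpa only [e] using h

theorem exists_normal_of_nonneg {T : K →L[ℂ] K} (hT : 0 ≤ T)
    (hs : Summable fun i => (⟪onb K i, T (onb K i)⟫_ℂ).re) :
    ∃ φ ∈ normalFunctionals K, ∀ Y : K →L[ℂ] K,
      HasSum (fun i => ⟪onb K i, T (Y (onb K i))⟫_ℂ) (φ Y) := by
  have hC : IsSelfAdjoint (CFC.sqrt T) := (CFC.sqrt_nonneg T).isSelfAdjoint
  have h2 : ∀ x, T x = CFC.sqrt T (CFC.sqrt T x) := fun x => by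
    conv_lhs => rw [← CFC.sqrt_mul_sqrt_self T hT]
    rfl
  have h3 : ∀ x, (⟪x, T x⟫_ℂ).re = ‖CFC.sqrt T x‖ ^ 2 := fun x => by
    rw [h2, ← ContinuousLinearMap.adjoint_inner_left, hC.adjoint_eq]
    exact inner_self_eq_norm_sq (𝕜 := ℂ) _
  simp only [h3] at hs
  simp only [h2]
  exact exists_normal_of_sq hC hs

omit [CompleteSpace K] in
theorem re_inner_nonneg_of_nonneg {T : K →L[ℂ] K} (hT : 0 ≤ T) (x : K) :
    0 ≤ (⟪x, T x⟫_ℂ).re :=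
  ((ContinuousLinearMap.nonneg_iff_isPositive T).1 hT).re_inner_nonneg_right x

/-- The functional `Y ↦ tr (T Y)` of a self-adjoint trace class operator `T` is normal. -/
theorem exists_normal_eq_trace {T : K →L[ℂ] K} (hT : IsSelfAdjoint T) (htc : IsTraceClass T) :
    ∃ φ ∈ normalFunctionals K, ∀ Y : K →L[ℂ] K,
      HasSum (fun i => ⟪onb K i, T (Y (onb K i))⟫_ℂ) (φ Y) := by
  have habs := CFC.posPart_add_negPart T hT
  have hsub := CFC.posPart_sub_negPart T hT
  have hre : ∀ x, (⟪x, CFC.abs T x⟫_ℂ).re = (⟪x, T⁺ x⟫_ℂ).re + (⟪x, T⁻ x⟫_ℂ).re := fun x => by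
    rw [← habs, add_apply, inner_add_right, Complex.add_re]
  have hp := CFC.posPart_nonneg T
  have hn := CFC.negPart_nonneg T
  -- Since `|T| = T⁺ + T⁻`, the diagonal entries of both parts are dominated by those of `|T|`.
  obtain ⟨φ, hφ, h1⟩ := exists_normal_of_nonneg hp (htc.of_nonneg_of_le
    (fun i => re_inner_nonneg_of_nonneg hp _) fun i => by
      rw [hre]
      exact le_add_of_nonneg_right (re_inner_nonneg_of_nonneg hn _))
  obtain ⟨ψ, hψ, h2⟩ := exists_normal_of_nonneg hn (htc.of_nonneg_of_le
    (fun i => re_inner_nonneg_of_nonneg hn _) fun i => by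
      rw [hre]
      exact le_add_of_nonneg_left (re_inner_nonneg_of_nonneg hp _))
  refine ⟨φ - ψ, Submodule.sub_mem _ hφ hψ, fun Y => ?_⟩
  have h := (h1 Y).sub (h2 Y)
  simpa only [← inner_sub_right, ← sub_apply, hsub] using h

/-- The operator `T` with `⟪u, T v⟫ = φ (|v⟩⟨u|)`. -/
def densityOperator (φ : (K →L[ℂ] K) →L[ℂ] ℂ) : K →L[ℂ] K :=
  ContinuousLinearMap.adjoint (continuousLinearMapOfBilin
    ((ContinuousLinearMap.compL ℂ K (K →L[ℂ] K) ℂ φ).comp (rankOne ℂ (E := K) (F := K)).flip))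

theorem inner_densityOperator (φ : (K →L[ℂ] K) →L[ℂ] ℂ) (u v : K) :
    ⟪u, densityOperator φ v⟫_ℂ = φ (rankOne ℂ v u) := by
  rw [densityOperator, ContinuousLinearMap.adjoint_inner_right, continuousLinearMapOfBilin_apply]
  rfl

theorem hasSum_normal_right {φ : (K →L[ℂ] K) →L[ℂ] ℂ} (hφ : φ ∈ normalFunctionals K)
    (Y : K →L[ℂ] K) : HasSum (fun i => φ (rankOne ℂ (Y (onb K i)) (onb K i))) (φ Y) := by
  have h := hasSum_normal hφ Y 1
  rw [← ContinuousLinearMap.star_eq_adjoint, star_one] at h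
  simpa only [mul_one, one_apply_eq_self] using h

theorem hasSum_normal_left {φ : (K →L[ℂ] K) →L[ℂ] ℂ} (hφ : φ ∈ normalFunctionals K)
    (Y : K →L[ℂ] K) : HasSum (fun i => φ (rankOne ℂ (onb K i) (Y.adjoint (onb K i)))) (φ Y) := by
  have h := hasSum_normal hφ 1 Y
  simpa only [one_mul, one_apply_eq_self] using h

theorem isSelfAdjoint_densityOperator {φ : (K →L[ℂ] K) →L[ℂ] ℂ}
    (h : ∀ u v, φ (rankOne ℂ u v) = (starRingEnd ℂ) (φ (rankOne ℂ v u))) :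
    IsSelfAdjoint (densityOperator φ) := by
  rw [ContinuousLinearMap.isSelfAdjoint_iff_isSymmetric]
  intro u v
  simp only [ContinuousLinearMap.coe_coe]
  rw [← inner_conj_symm, inner_densityOperator, inner_densityOperator, ← h]

/-- Normality enters here: only for such `φ` do the values on the rank one pieces of `Y` add up to
`φ Y`. -/
theorem trace_densityOperator_mul {φ : (K →L[ℂ] K) →L[ℂ] ℂ} (hφ : φ ∈ normalFunctionals K)
    (Y : K →L[ℂ] K) : trace (densityOperator φ * Y) = φ Y := by
  rw [← (hasSum_normal_right hφ Y).tsum_eq, trace]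
  refine tsum_congr fun i => ?_
  rw [mul_apply_eq_comp, inner_densityOperator]

/-- The operator `U` is an approximate polar factor from the continuous functional calculus. The
sign function is replaced by `x / ε` clamped to `[-1, 1]`; then `|x| - f x * x` vanishes for `|x| ≥
ε` and lies in `[0, ε]` otherwise. -/
theorem exists_norm_abs_sub_mul_le {T : K →L[ℂ] K} (hT : IsSelfAdjoint T) {ε : ℝ} (hε : 0 < ε) :
    ∃ U : K →L[ℂ] K, ‖U‖ ≤ 1 ∧ ‖CFC.abs T - U * T‖ ≤ ε := by
  let f : ℝ → ℝ := fun x => max (-1) (min 1 (x / ε))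
  have hf : Continuous f := by fun_prop
  refine ⟨cfc f T, ?_, ?_⟩
  · refine norm_cfc_le zero_le_one fun x _ => ?_
    rw [Real.norm_eq_abs, abs_le]
    exact ⟨le_max_left _ _, max_le (by norm_num) (min_le_left _ _)⟩
  · have e : CFC.abs T - cfc f T * T = cfc (fun x : ℝ => ‖x‖ - f x * x) T := by
      rw [cfc_sub (fun x : ℝ => ‖x‖) (fun x => f x * x) T, cfc_mul f (fun x => x) T,
        CFC.abs_eq_cfc_norm T hT, cfc_id' ℝ T]
    rw [e]
    refine norm_cfc_le hε.le fun x _ => ?_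
    simp only [f, Real.norm_eq_abs]
    rcases le_total 1 (x / ε) with h | h
    · have hx : 0 ≤ x := by
        rw [le_div_iff₀ hε] at h
        linarith
      rw [min_eq_left h, max_eq_right (by norm_num), abs_of_nonneg hx]
      simpa using hε.le
    rw [min_eq_right h]
    rcases le_total (x / ε) (-1) with h' | h'
    · have hx : x ≤ 0 := by
        rw [div_le_iff₀ hε] at h'
        linarith
      rw [max_eq_left h', abs_of_nonpos hx]
      simpa using hε.le
    rw [max_eq_right h']
    have h1 : |x| ≤ ε := by
      rw [div_le_iff₀ hε] at h
      rw [le_div_iff₀ hε] at h'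
      exact abs_le.2 ⟨by linarith, by linarith⟩
    have h2 : x / ε * x = |x| * |x| / ε := by
      rw [abs_mul_abs_self]
      ring
    rw [h2, abs_le]
    have h3 : |x| * |x| / ε ≤ |x| := by
      rw [div_le_iff₀ hε]
      exact mul_le_mul_of_nonneg_left h1 (abs_nonneg _)
    have h4 : 0 ≤ |x| * |x| / ε := by positivity
    constructor <;> linarith

/-- With `U` close to the polar factor, a partial trace of `|T|` is nearly that of `U T`, which is
`φ (P U)` for a projection `P` and hence at most `‖φ‖`. -/
theorem isTraceClass_densityOperator {φ : (K →L[ℂ] K) →L[ℂ] ℂ}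
    (h : ∀ u v, φ (rankOne ℂ u v) = (starRingEnd ℂ) (φ (rankOne ℂ v u))) :
    IsTraceClass (densityOperator φ) := by
  set T := densityOperator φ
  have hT : IsSelfAdjoint T := isSelfAdjoint_densityOperator h
  refine summable_of_sum_le (c := ‖φ‖)
    (fun i => re_inner_nonneg_of_nonneg (CFC.abs_nonneg T) _) fun F => ?_
  refine le_of_forall_pos_le_add fun δ hδ => ?_
  -- Each of the `F.card` diagonal entries has an error of at most this `ε`, so that the total error
  -- stays below `δ`.
  obtain ⟨U, hU, hUT⟩ := exists_norm_abs_sub_mul_le hT (ε := δ / (F.card + 1)) (by positivity)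
  have h1 : ∀ i, ⟪onb K i, (U * T) (onb K i)⟫_ℂ =
      φ (rankOne ℂ (onb K i) (U.adjoint (onb K i))) := fun i =>
    (ContinuousLinearMap.adjoint_inner_left U _ _).symm.trans (inner_densityOperator φ _ _)
  have h2 : ∑ i ∈ F, ⟪onb K i, (U * T) (onb K i)⟫_ℂ = φ (1 * basisProj F * U) := by
    rw [mul_basisProj_mul, map_sum]
    exact Finset.sum_congr rfl fun i _ => h1 i
  have h3 : (∑ i ∈ F, ⟪onb K i, (U * T) (onb K i)⟫_ℂ).re ≤ ‖φ‖ := by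
    refine (Complex.re_le_norm _).trans ?_
    rw [h2, one_mul]
    calc ‖φ (basisProj F * U)‖ ≤ ‖φ‖ * ‖basisProj F * U‖ := φ.le_opNorm _
      _ ≤ ‖φ‖ * (1 * 1) := by
        gcongr
        exact (norm_mul_le _ _).trans
          (mul_le_mul (norm_basisProj_le F) hU (norm_nonneg _) zero_le_one)
      _ = ‖φ‖ := by ring
  have h4 : ∀ i, (⟪onb K i, CFC.abs T (onb K i)⟫_ℂ).re ≤
      (⟪onb K i, (U * T) (onb K i)⟫_ℂ).re + δ / (F.card + 1) := fun i => by
    have e : ⟪onb K i, CFC.abs T (onb K i)⟫_ℂ = ⟪onb K i, (U * T) (onb K i)⟫_ℂ +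
        ⟪onb K i, (CFC.abs T - U * T) (onb K i)⟫_ℂ := by
      rw [← inner_add_right, sub_apply, add_sub_cancel]
    rw [e, Complex.add_re]
    gcongr
    refine (Complex.re_le_norm _).trans ((norm_inner_le_norm _ _).trans ?_)
    have h5 := (CFC.abs T - U * T).le_opNorm (onb K i)
    rw [(onb K).orthonormal.1 i, mul_one] at h5
    rw [(onb K).orthonormal.1 i, one_mul]
    exact h5.trans hUT
  calc _ ≤ ∑ i ∈ F, ((⟪onb K i, (U * T) (onb K i)⟫_ℂ).re + δ / (F.card + 1)) :=
        Finset.sum_le_sum fun i _ => h4 i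
    _ = (∑ i ∈ F, ⟪onb K i, (U * T) (onb K i)⟫_ℂ).re + F.card * (δ / (F.card + 1)) := by
        rw [Finset.sum_add_distrib, Complex.re_sum, Finset.sum_const, nsmul_eq_mul]
    _ ≤ ‖φ‖ + δ := by
        refine add_le_add h3 ?_
        have h6 : (F.card : ℝ) / (F.card + 1) ≤ 1 := by
          rw [div_le_one (Nat.cast_add_one_pos _)]
          exact le_add_of_nonneg_right zero_le_one
        calc (F.card : ℝ) * (δ / (F.card + 1)) = F.card / (F.card + 1) * δ := by ring
          _ ≤ 1 * δ := mul_le_mul_of_nonneg_right h6 hδ.le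
          _ = δ := one_mul δ

variable {T : K →L[ℂ] K} {φ : (K →L[ℂ] K) →L[ℂ] ℂ}

theorem apply_rankOne_of_hasSum
    (h : ∀ Y : K →L[ℂ] K, HasSum (fun i => ⟪onb K i, T (Y (onb K i))⟫_ℂ) (φ Y)) (u v : K) :
    φ (rankOne ℂ v u) = ⟪u, T v⟫_ℂ := by
  have h1 := h (rankOne ℂ v u)
  simp only [rankOne_apply, map_smul, inner_smul_right] at h1
  exact h1.unique ((onb K).hasSum_inner_mul_inner u (T v))

/-- The functional `Y ↦ tr (T Y)` is hermitian if `T` is self-adjoint. -/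
theorem map_adjoint_of_hasSum (hT : IsSelfAdjoint T) (hφ : φ ∈ normalFunctionals K)
    (h : ∀ Y : K →L[ℂ] K, HasSum (fun i => ⟪onb K i, T (Y (onb K i))⟫_ℂ) (φ Y))
    (Y : K →L[ℂ] K) : φ Y.adjoint = (starRingEnd ℂ) (φ Y) := by
  have h1 := hasSum_normal_left hφ Y.adjoint
  have h2 := Complex.hasSum_conj'.2 (hasSum_normal_right hφ Y)
  simp only [ContinuousLinearMap.adjoint_adjoint, apply_rankOne_of_hasSum h] at h1 h2
  refine h1.unique ?_
  have e : ∀ i, (starRingEnd ℂ) ⟪onb K i, T (Y (onb K i))⟫_ℂ = ⟪Y (onb K i), T (onb K i)⟫_ℂ :=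
    fun i => by
      rw [inner_conj_symm, ← ContinuousLinearMap.adjoint_inner_right, hT.adjoint_eq]
  simpa only [e] using h2

/-- The functional `Y ↦ tr (T Y)` is positive if `T` is positive. -/
theorem map_nonneg_of_hasSum (hT : T.IsPositive) (hφ : φ ∈ normalFunctionals K)
    (h : ∀ Y : K →L[ℂ] K, HasSum (fun i => ⟪onb K i, T (Y (onb K i))⟫_ℂ) (φ Y))
    {Y : K →L[ℂ] K} (hY : 0 ≤ Y) : 0 ≤ φ Y := by
  -- Splitting `Y` symmetrically makes each term `⟪√Y e_i, T (√Y e_i)⟫`.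
  have h1 := hasSum_normal hφ (CFC.sqrt Y) (CFC.sqrt Y)
  rw [CFC.sqrt_mul_sqrt_self Y hY, (CFC.sqrt_nonneg Y).isSelfAdjoint.adjoint_eq] at h1
  refine h1.nonneg fun i => ?_
  rw [apply_rankOne_of_hasSum h]
  exact hT.inner_nonneg_right _

end TraceClass

/-! ### Operators on Hilbert tensor products -/

section TensorOperators

universe u

variable {ι : Type*} [Fintype ι] {H : ι → Type u} [∀ i, NormedAddCommGroup (H i)]
  [∀ i, InnerProductSpace ℂ (H i)]

theorem topologicalClosure_span_simpleTensor :
    (Submodule.span ℂ (Set.range (simpleTensor (H := H)))).topologicalClosure = ⊤ := by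
  rw [← Submodule.dense_iff_topologicalClosure_eq_top]
  refine (denseRange_toHilbertTensor (H := H)).mono ?_
  rintro _ ⟨t, rfl⟩
  obtain ⟨c, rfl⟩ := exists_sum_algTprod t
  rw [Finsupp.sum, map_sum]
  refine Submodule.sum_mem _ fun x _ => ?_
  rw [map_smul]
  exact Submodule.smul_mem _ _ (Submodule.subset_span ⟨x, rfl⟩)

theorem hilbertTensor_induction {C : Submodule ℂ (HilbertTensor H)}
    (hC : IsClosed (C : Set (HilbertTensor H))) (h : ∀ x, simpleTensor x ∈ C)
    (t : HilbertTensor H) : t ∈ C := by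
  have h1 := Submodule.topologicalClosure_minimal _
    (Submodule.span_le.2 (Set.range_subset_iff.2 h)) hC
  rw [topologicalClosure_span_simpleTensor] at h1
  exact h1 trivial

theorem hilbertTensor_hom_ext {E : Type*} [NormedAddCommGroup E] [NormedSpace ℂ E]
    {f g : HilbertTensor H →L[ℂ] E} (h : ∀ x, f (simpleTensor x) = g (simpleTensor x)) : f = g := by
  ext t
  exact hilbertTensor_induction (C := LinearMap.eqLocus f.toLinearMap g.toLinearMap)
    (isClosed_eq f.continuous g.continuous) h t

theorem hilbertTensor_op_ext {A B : HilbertTensor H →L[ℂ] HilbertTensor H}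
    (h : ∀ x y, ⟪simpleTensor x, A (simpleTensor y)⟫_ℂ = ⟪simpleTensor x, B (simpleTensor y)⟫_ℂ) :
    A = B := by
  refine hilbertTensor_hom_ext fun y => ext_inner_left ℂ fun t => ?_
  rw [← inner_conj_symm, ← inner_conj_symm t]
  congr 1
  have := hilbertTensor_hom_ext (f := innerSL ℂ (A (simpleTensor y)))
    (g := innerSL ℂ (B (simpleTensor y))) fun x => by
      simp only [innerSL_apply_apply]
      rw [← inner_conj_symm, h, inner_conj_symm]
  exact DFunLike.congr_fun this t

/-- The functional `vecFunctional u v` depends continuously on `u` and on `v` separately, and simple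
tensors span a dense subspace; so `v` is extended first, then `u`, where the dependence is conjugate
linear. -/
theorem normal_mem_of_simpleTensor
    {C : Submodule ℂ ((HilbertTensor H →L[ℂ] HilbertTensor H) →L[ℂ] ℂ)}
    (hC : IsClosed (C : Set ((HilbertTensor H →L[ℂ] HilbertTensor H) →L[ℂ] ℂ)))
    (h : ∀ x y, vecFunctional (simpleTensor x) (simpleTensor y) ∈ C) :
    normalFunctionals (HilbertTensor H) ≤ C := by
  refine normalFunctionals_le hC fun u v => ?_
  have hv : ∀ x, vecFunctional (simpleTensor x) v ∈ C := fun x => by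
    let f : HilbertTensor H →L[ℂ] ((HilbertTensor H →L[ℂ] HilbertTensor H) →L[ℂ] ℂ) :=
      LinearMap.mkContinuous
        { toFun := fun v => vecFunctional (simpleTensor x) v
          map_add' := fun a b => by ext Y; simp
          map_smul' := fun c a => by ext Y; simp }
        ‖simpleTensor x‖ fun v => norm_vecFunctional_le _ _
    exact hilbertTensor_induction (C := C.comap f.toLinearMap) (hC.preimage f.continuous)
      (h x) v
  let f : HilbertTensor H →L⋆[ℂ] ((HilbertTensor H →L[ℂ] HilbertTensor H) →L[ℂ] ℂ) :=
    LinearMap.mkContinuous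
      { toFun := fun u => vecFunctional u v
        map_add' := fun a b => by ext Y; simp
        map_smul' := fun c a => by ext Y; simp [mul_comm] }
      ‖v‖ fun u => (norm_vecFunctional_le _ _).trans_eq (mul_comm _ _)
  exact hilbertTensor_induction (C := C.comap f.toLinearMap) (hC.preimage f.continuous) hv u

theorem tensorMap_mul (A B : ∀ i, H i →L[ℂ] H i) :
    tensorMap A * tensorMap B = tensorMap fun i => A i * B i :=
  hilbertTensor_hom_ext fun x => by simp [tensorMap_simpleTensor]

theorem tensorMap_one : tensorMap (fun i => (1 : H i →L[ℂ] H i)) = 1 :=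
  hilbertTensor_hom_ext fun x => by simp [tensorMap_simpleTensor]

theorem inner_tensorMap_simpleTensor (A : ∀ i, H i →L[ℂ] H i) (x y : ∀ i, H i) :
    ⟪simpleTensor x, tensorMap A (simpleTensor y)⟫_ℂ = ∏ i, ⟪x i, A i (y i)⟫_ℂ := by
  rw [tensorMap_simpleTensor, inner_simpleTensor]

theorem norm_tensorMap_le (A : ∀ i, H i →L[ℂ] H i) : ‖tensorMap A‖ ≤ ∏ i, ‖A i‖ := by
  refine ContinuousLinearMap.opNorm_le_bound _ (Finset.prod_nonneg fun i _ => norm_nonneg _)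
    fun t => ?_
  induction t using UniformSpace.Completion.induction_on with
  | hp => exact isClosed_le (by fun_prop) (by fun_prop)
  | ih t =>
    rw [tensorMap_coe, UniformSpace.Completion.norm_coe, UniformSpace.Completion.norm_coe]
    exact norm_algTensorMap_le A t

section Complete

variable [∀ i, CompleteSpace (H i)]

theorem adjoint_tensorMap (A : ∀ i, H i →L[ℂ] H i) :
    (tensorMap A).adjoint = tensorMap fun i => (A i).adjoint :=
  hilbertTensor_op_ext fun x y => by
    rw [ContinuousLinearMap.adjoint_inner_right, tensorMap_simpleTensor,
      inner_tensorMap_simpleTensor, inner_simpleTensor]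
    simp only [ContinuousLinearMap.adjoint_inner_right]

theorem tensorMap_nonneg {A : ∀ i, H i →L[ℂ] H i} (hA : ∀ i, 0 ≤ A i) : 0 ≤ tensorMap A := by
  have e : tensorMap A = star (tensorMap fun i => CFC.sqrt (A i)) *
      tensorMap fun i => CFC.sqrt (A i) := by
    rw [ContinuousLinearMap.star_eq_adjoint, adjoint_tensorMap, tensorMap_mul]
    congr 1
    ext1 i
    rw [(CFC.sqrt_nonneg (A i)).isSelfAdjoint.adjoint_eq, CFC.sqrt_mul_sqrt_self _ (hA i)]
  rw [e]
  exact star_mul_self_nonneg _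

end Complete

/-- A map on the product that has the inner products of simple tensors extends to the Hilbert
tensor product. -/
theorem exists_lift_of_inner {E : Type*} [NormedAddCommGroup E] [InnerProductSpace ℂ E]
    [CompleteSpace E] (f : (∀ i, H i) → E) (hf : ∀ x y, ⟪f x, f y⟫_ℂ = ∏ i, ⟪x i, y i⟫_ℂ) :
    ∃ J : HilbertTensor H →L[ℂ] E, ∀ x, J (simpleTensor x) = f x := by
  let e : ((∀ i, H i) →₀ ℂ) →ₗ[ℂ] HilbertTensor H := Finsupp.linearCombination ℂ simpleTensor
  let g : ((∀ i, H i) →₀ ℂ) →ₗ[ℂ] E := Finsupp.linearCombination ℂ f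
  -- Equal Gram kernels give equal norms of all finite combinations; hence `g` factors through `e`
  -- and extends from its dense range.
  have hnorm : ∀ c, ‖g c‖ ≤ 1 * ‖e c‖ := fun c => by
    rw [one_mul]
    refine le_of_sq_le_sq ?_ (norm_nonneg _)
    rw [← @inner_self_eq_norm_sq ℂ, ← @inner_self_eq_norm_sq ℂ]
    simp only [e, g, Finsupp.linearCombination_apply, Finsupp.sum, sum_inner, inner_sum,
      inner_smul_left, inner_smul_right, hf, inner_simpleTensor]
    exact le_rfl
  have hdense : DenseRange e := by
    have h := topologicalClosure_span_simpleTensor (H := H)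
    rw [← Finsupp.range_linearCombination, ← Submodule.dense_iff_topologicalClosure_eq_top] at h
    exact h
  refine ⟨g.extendOfNorm e, fun x => ?_⟩
  have h := LinearMap.extendOfNorm_eq (f := g) hdense ⟨1, hnorm⟩ (Finsupp.single x 1)
  simpa [e, g] using h

end TensorOperators

/-! ### The operator `Y ⊗ 1` -/

section Amplification

universe u

/-- A family of two spaces. -/
def Pair (E F : Type u) : Bool → Type u
  | true => E
  | false => F

variable {E F : Type u} [NormedAddCommGroup E] [InnerProductSpace ℂ E]
  [NormedAddCommGroup F] [InnerProductSpace ℂ F]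

instance : ∀ b, NormedAddCommGroup (Pair E F b)
  | true => inferInstanceAs (NormedAddCommGroup E)
  | false => inferInstanceAs (NormedAddCommGroup F)

instance : ∀ b, InnerProductSpace ℂ (Pair E F b)
  | true => inferInstanceAs (InnerProductSpace ℂ E)
  | false => inferInstanceAs (InnerProductSpace ℂ F)

/-- A pair of vectors. -/
def pairVec (x : E) (y : F) : ∀ b, Pair E F b
  | true => x
  | false => y

/-- The pair `(Y, 1)` of operators. -/
def pairOp (Y : E →L[ℂ] E) : ∀ b, Pair E F b →L[ℂ] Pair E F b
  | true => Y
  | false => ContinuousLinearMap.id ℂ F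

theorem inner_pairVec (x x' : E) (y y' : F) :
    ⟪simpleTensor (pairVec x y), simpleTensor (pairVec x' y')⟫_ℂ = ⟪x, x'⟫_ℂ * ⟪y, y'⟫_ℂ := by
  rw [inner_simpleTensor, Fintype.prod_bool]
  rfl

omit [NormedAddCommGroup E] [InnerProductSpace ℂ E] [NormedAddCommGroup F]
  [InnerProductSpace ℂ F] in
theorem pairVec_eta (x : ∀ b, Pair E F b) : pairVec (E := E) (F := F) (x true) (x false) = x := by
  ext b
  cases b <;> rfl

theorem inner_tensorMap_pairOp (Y : E →L[ℂ] E) (x x' : E) (y y' : F) :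
    ⟪simpleTensor (pairVec x y), tensorMap (pairOp (F := F) Y) (simpleTensor (pairVec x' y'))⟫_ℂ =
      ⟪x, Y x'⟫_ℂ * ⟪y, y'⟫_ℂ := by
  rw [inner_tensorMap_simpleTensor, Fintype.prod_bool]
  rfl

theorem pair_op_ext {A B : HilbertTensor (Pair E F) →L[ℂ] HilbertTensor (Pair E F)}
    (h : ∀ x y x' y', ⟪simpleTensor (pairVec x y), A (simpleTensor (pairVec x' y'))⟫_ℂ =
      ⟪simpleTensor (pairVec x y), B (simpleTensor (pairVec x' y'))⟫_ℂ) : A = B :=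
  hilbertTensor_op_ext fun x y => by
    rw [← pairVec_eta x, ← pairVec_eta y]
    exact h _ _ _ _

variable (E F) in
/-- The map `Y ↦ Y ⊗ 1`. -/
def amplification :
    (E →L[ℂ] E) →L[ℂ] (HilbertTensor (Pair E F) →L[ℂ] HilbertTensor (Pair E F)) :=
  LinearMap.mkContinuous
    { toFun := fun Y => tensorMap (pairOp (F := F) Y)
      map_add' := fun A B => pair_op_ext fun x y x' y' => by
        simp only [add_apply, inner_add_right, inner_tensorMap_pairOp, add_mul]
      map_smul' := fun c A => pair_op_ext fun x y x' y' => by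
        simp only [smul_apply, inner_smul_right, inner_tensorMap_pairOp, RingHom.id_apply,
          mul_assoc] }
    1 fun Y => by
      refine (norm_tensorMap_le _).trans ?_
      rw [Fintype.prod_bool, one_mul]
      exact mul_le_of_le_one_right (norm_nonneg _) ContinuousLinearMap.norm_id_le

theorem inner_amplification (Y : E →L[ℂ] E) (x x' : E) (y y' : F) :
    ⟪simpleTensor (pairVec x y), amplification E F Y (simpleTensor (pairVec x' y'))⟫_ℂ =
      ⟪x, Y x'⟫_ℂ * ⟪y, y'⟫_ℂ :=
  inner_tensorMap_pairOp Y x x' y y'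

theorem adjoint_amplification [CompleteSpace E] (Y : E →L[ℂ] E) :
    (amplification E F Y).adjoint = amplification E F Y.adjoint :=
  pair_op_ext fun x y x' y' => by
    rw [ContinuousLinearMap.adjoint_inner_right, ← inner_conj_symm, inner_amplification,
      inner_amplification, map_mul, inner_conj_symm, inner_conj_symm,
      ContinuousLinearMap.adjoint_inner_right]

end Amplification

/-! ### Vector measures on a product -/

section Boxes

variable {ι : Type*} [Fintype ι] {Λ : ι → Type*} [∀ i, MeasurableSpace (Λ i)]

variable (Λ) in
/-- The measurable rectangles, and the empty set. -/
def boxes : Set (Set (∀ i, Λ i)) :=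
  insert ∅ (Set.univ.pi '' Set.univ.pi fun i => {s : Set (Λ i) | MeasurableSet s})

omit [Fintype ι] in
theorem pi_mem_boxes {F : ∀ i, Set (Λ i)} (hF : ∀ i, MeasurableSet (F i)) :
    Set.univ.pi F ∈ boxes Λ :=
  Or.inr ⟨F, fun i _ => hF i, rfl⟩

omit [Fintype ι] in
theorem univ_mem_boxes : Set.univ ∈ boxes Λ := by
  rw [← Set.pi_univ Set.univ]
  exact pi_mem_boxes fun _ => MeasurableSet.univ

omit [Fintype ι] in
theorem boxes_cases {R : Set (∀ i, Λ i)} (hR : R ∈ boxes Λ) :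
    R = ∅ ∨ ∃ F : ∀ i, Set (Λ i), (∀ i, MeasurableSet (F i)) ∧ R = Set.univ.pi F := by
  rcases hR with rfl | ⟨F, hF, rfl⟩
  · exact Or.inl rfl
  · exact Or.inr ⟨F, fun i => hF i trivial, rfl⟩

theorem measurableSet_of_mem_boxes {R : Set (∀ i, Λ i)} (hR : R ∈ boxes Λ) : MeasurableSet R := by
  rcases boxes_cases hR with rfl | ⟨F, hF, rfl⟩
  · exact MeasurableSet.empty
  · exact MeasurableSet.univ_pi hF

theorem generateFrom_boxes :
    (inferInstance : MeasurableSpace (∀ i, Λ i)) = MeasurableSpace.generateFrom (boxes Λ) := by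
  rw [boxes, MeasurableSpace.generateFrom_insert_empty, generateFrom_pi]

theorem isSetSemiring_boxes : IsSetSemiring (boxes Λ) where
  empty_mem := Set.mem_insert _ _
  inter_mem := by
    intro s hs t ht
    rcases boxes_cases hs with rfl | ⟨F, hF, rfl⟩
    · simpa using hs
    rcases boxes_cases ht with rfl | ⟨G, hG, rfl⟩
    · simpa using ht
    rw [← Set.pi_inter_distrib]
    exact pi_mem_boxes fun i => (hF i).inter (hG i)
  sdiff_eq_sUnion' := by
    classical
    intro s hs t ht
    rcases boxes_cases hs with rfl | ⟨F, hF, rfl⟩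
    · exact ⟨∅, by simp⟩
    rcases boxes_cases ht with rfl | ⟨G, hG, rfl⟩
    · exact ⟨{Set.univ.pi F}, by simpa using hs⟩
    -- The box `D σ` consists of the points of `F` whose coordinates leave `G` exactly at the
    -- indices in `σ`. The nonempty `σ` partition the difference into boxes.
    let D : Finset ι → Set (∀ i, Λ i) := fun σ =>
      Set.univ.pi fun i => if i ∈ σ then F i \ G i else F i ∩ G i
    have hD : ∀ σ l, l ∈ D σ ↔ ∀ i, l i ∈ F i ∧ (i ∈ σ ↔ l i ∉ G i) := by
      intro σ l
      simp only [D, Set.mem_univ_pi]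
      refine forall_congr' fun i => ?_
      by_cases h : i ∈ σ <;> simp [h]
    refine ⟨(Finset.univ.erase ∅).image D, ?_, ?_, ?_⟩
    · intro R hR
      obtain ⟨σ, -, rfl⟩ := Finset.mem_image.1 hR
      refine pi_mem_boxes fun i => ?_
      split_ifs
      · exact (hF i).diff (hG i)
      · exact (hF i).inter (hG i)
    · intro R hR R' hR' hne
      obtain ⟨σ, -, rfl⟩ := Finset.mem_image.1 hR
      obtain ⟨σ', -, rfl⟩ := Finset.mem_image.1 hR'
      refine Set.disjoint_left.2 fun l hl hl' => hne ?_
      have : σ = σ' := by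
        ext i
        rw [((hD σ l).1 hl i).2, ((hD σ' l).1 hl' i).2]
      rw [this]
    · ext l
      simp only [Set.mem_sdiff, Finset.coe_image, Set.sUnion_image, Set.mem_iUnion, hD,
        Set.mem_univ_pi]
      constructor
      · rintro ⟨h1, h2⟩
        refine ⟨Finset.univ.filter fun i => l i ∉ G i, ?_, fun i => ⟨h1 i, by simp⟩⟩
        simp only [Finset.coe_erase, Set.mem_sdiff, Finset.mem_coe, Finset.mem_univ, true_and,
          Set.mem_singleton_iff, Finset.filter_eq_empty_iff, not_forall]
        push Not at h2 ⊢
        obtain ⟨i, hi⟩ := h2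
        exact ⟨i, trivial, hi⟩
      · rintro ⟨σ, hσ, h⟩
        refine ⟨fun i => (h i).1, fun h2 => ?_⟩
        simp only [Finset.coe_erase, Set.mem_sdiff, Finset.mem_coe, Finset.mem_univ, true_and,
          Set.mem_singleton_iff] at hσ
        obtain ⟨i, hi⟩ := Finset.nonempty_iff_ne_empty.2 hσ
        exact ((h i).2.1 hi) (h2 i)

theorem vectorMeasure_ext_boxes {E : Type*} [AddCommGroup E] [TopologicalSpace E] [T2Space E]
    {μ ν : VectorMeasure (∀ i, Λ i) E}
    (h : ∀ F : ∀ i, Set (Λ i), (∀ i, MeasurableSet (F i)) →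
      μ (Set.univ.pi F) = ν (Set.univ.pi F)) : μ = ν := by
  have h' : ∀ s ∈ boxes Λ, μ s = ν s := by
    intro s hs
    rcases boxes_cases hs with rfl | ⟨F, hF, rfl⟩
    · simp
    · exact h F hF
  exact VectorMeasure.ext_of_generateFrom (boxes Λ) h' generateFrom_boxes
    isSetSemiring_boxes.isPiSystem (h' _ univ_mem_boxes)

end Boxes

/-! ### Approximation and uniform limits of complex measures -/

section Approximation

variable {X : Type*} [MeasurableSpace X]

/-- The values of a complex measure are limits of its values on finite unions of sets of a
generating semiring. -/
theorem exists_mem_supClosure_norm_sub_lt {C : Set (Set X)} (hC : IsSetSemiring C)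
    (huniv : Set.univ ∈ C) (hgen : (inferInstance : MeasurableSpace X) = .generateFrom C)
    (ν : VectorMeasure X ℂ) {E : Set X} (hE : MeasurableSet E) {ε : ℝ} (hε : 0 < ε) :
    ∃ t ∈ supClosure C, ‖ν E - ν t‖ < ε := by
  -- The total variations of the real and imaginary parts add up to a finite positive measure `m`
  -- that dominates `‖ν ·‖`, so approximation in `m`-measure suffices.
  let r : SignedMeasure X := ν.mapRange Complex.reAddGroupHom Complex.continuous_re
  let j : SignedMeasure X := ν.mapRange Complex.imAddGroupHom Complex.continuous_im
  let m : Measure X := r.totalVariation + j.totalVariation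
  have hm : ∀ A, ‖ν A‖ₑ ≤ m A := fun A => by
    have h1 : ‖ν A‖ₑ ≤ ‖r A‖ₑ + ‖j A‖ₑ := by
      rw [← ofReal_norm, ← ofReal_norm, ← ofReal_norm, ← ENNReal.ofReal_add (norm_nonneg _)
        (norm_nonneg _)]
      exact ENNReal.ofReal_le_ofReal (Complex.norm_le_abs_re_add_abs_im _)
    exact h1.trans (add_le_add (r.enorm_le_totalVariation A) (j.enorm_le_totalVariation A))
  obtain ⟨t, ht, hlt⟩ := exists_measure_symmDiff_lt_of_generateFrom_isSetSemiring (μ := m) hC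
    ⟨{Set.univ}, Set.countable_singleton _, by simpa using huniv, by simp⟩ hgen hE
    (ENNReal.ofReal_pos.2 hε)
  refine ⟨t, ht, ?_⟩
  have htm : MeasurableSet t := by
    have : MeasurableSet[.generateFrom C] t := measurableSet_generateFrom_of_mem_supClosure ht
    rwa [← hgen] at this
  have e1 := ν.of_add_of_sdiff (hE.inter htm) hE Set.inter_subset_left
  have e2 := ν.of_add_of_sdiff (hE.inter htm) htm Set.inter_subset_right
  rw [Set.sdiff_self_inter] at e1
  rw [Set.sdiff_inter_self_eq_sdiff] at e2
  have e3 : ν E - ν t = ν (E \ t) - ν (t \ E) := by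
    rw [← e1, ← e2]
    ring
  have h3 : ‖ν E - ν t‖ₑ ≤ m (symmDiff t E) := by
    rw [e3, Set.symmDiff_def, measure_union disjoint_sdiff_sdiff (hE.diff htm), add_comm]
    exact (enorm_sub_le).trans (add_le_add (hm _) (hm _))
  rw [← ENNReal.ofReal_lt_ofReal_iff hε, ofReal_norm]
  exact h3.trans_lt hlt

/-- A uniform limit of complex measures is a complex measure. -/
theorem exists_vectorMeasure_of_uniform_limit {ν : ℕ → VectorMeasure X ℂ} {m : Set X → ℂ}
    {b : ℕ → ℝ} (hb : Tendsto b atTop (𝓝 0))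
    (h : ∀ n E, MeasurableSet E → ‖ν n E - m E‖ ≤ b n) :
    ∃ μ : VectorMeasure X ℂ, ∀ E, MeasurableSet E → μ E = m E := by
  classical
  have hlim : ∀ E, MeasurableSet E → Tendsto (fun n => ν n E) atTop (𝓝 (m E)) := fun E hE =>
    tendsto_iff_norm_sub_tendsto_zero.2
      (squeeze_zero (fun _ => norm_nonneg _) (fun n => h n E hE) hb)
  have hfin : ∀ (f : ℕ → Set X), (∀ i, MeasurableSet (f i)) →
      Pairwise (Function.onFun Disjoint f) → ∀ s : Finset ℕ,
      m (⋃ i ∈ s, f i) = ∑ i ∈ s, m (f i) := fun f hf hd s => by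
    refine tendsto_nhds_unique (hlim _ (s.measurableSet_biUnion fun i _ => hf i)) ?_
    have e : ∀ n, ν n (⋃ i ∈ s, f i) = ∑ i ∈ s, ν n (f i) := fun n =>
      VectorMeasure.of_biUnion_finset (hd.set_pairwise _) fun i _ => hf i
    simp only [e]
    exact tendsto_finsetSum _ fun i _ => hlim _ (hf i)
  refine ⟨⟨fun E => if MeasurableSet E then m E else 0, ?_, fun E hE => if_neg hE, ?_⟩,
    fun E hE => if_pos hE⟩
  · rw [if_pos MeasurableSet.empty]
    refine tendsto_nhds_unique (hlim _ MeasurableSet.empty) ?_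
    simp
  · intro f hf hd
    have hU := MeasurableSet.iUnion hf
    simp only [hf, hU, if_true]
    rw [HasSum, SummationFilter.unconditional_filter, Metric.tendsto_atTop]
    intro ε hε
    obtain ⟨n, hn⟩ := (hb.eventually (gt_mem_nhds (show 0 < ε / 3 by positivity))).exists
    obtain ⟨s₀, hs₀⟩ := Metric.tendsto_atTop.1
      (show Tendsto (fun s : Finset ℕ => ∑ i ∈ s, ν n (f i)) atTop (𝓝 (ν n (⋃ i, f i))) by
        simpa only [HasSum, SummationFilter.unconditional_filter] using
          VectorMeasure.m_iUnion (ν n) hf hd) (ε / 3) (by positivity)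
    refine ⟨s₀, fun s hs => ?_⟩
    have h1 := hs₀ s hs
    have h2 := h n _ hU
    have h3 := h n _ (s.measurableSet_biUnion fun i _ => hf i)
    rw [VectorMeasure.of_biUnion_finset (hd.set_pairwise _) fun i _ => hf i, hfin f hf hd] at h3
    rw [← dist_eq_norm] at h2 h3
    have h4 := dist_triangle4 (∑ i ∈ s, m (f i)) (∑ i ∈ s, ν n (f i)) (ν n (⋃ i, f i))
      (m (⋃ i, f i))
    rw [dist_comm (∑ i ∈ s, m (f i)) (∑ i ∈ s, ν n (f i))] at h4
    linarith

/-- The functionals that are represented by complex measures form a closed set if the measures are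
bounded by the norms of the functionals. -/
theorem isClosed_setOf_exists_vectorMeasure {V J : Type*} [NormedAddCommGroup V] [NormedSpace ℂ V]
    {s : J → Set X} (hs : ∀ j, MeasurableSet (s j)) (L : J → V →L[ℂ] ℂ)
    (hbound : ∀ φ (ν : VectorMeasure X ℂ), (∀ j, ν (s j) = L j φ) →
      ∀ E, MeasurableSet E → ‖ν E‖ ≤ ‖φ‖) :
    IsClosed {φ : V | ∃ ν : VectorMeasure X ℂ, ∀ j, ν (s j) = L j φ} := by
  refine isClosed_of_closure_subset fun φ hφ => ?_
  obtain ⟨f, hf, hlim⟩ := mem_closure_iff_seq_limit.1 hφ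
  choose ν hν using hf
  have hdist : ∀ n k E, MeasurableSet E → ‖ν n E - ν k E‖ ≤ ‖f n - f k‖ := fun n k E hE => by
    simpa using hbound (f n - f k) (ν n - ν k) (fun j => by simp [hν]) E hE
  have hcau : ∀ E, MeasurableSet E → ∃ z, Tendsto (fun n => ν n E) atTop (𝓝 z) := fun E hE => by
    refine cauchySeq_tendsto_of_complete (Metric.cauchySeq_iff'.2 fun ε hε => ?_)
    obtain ⟨N, hN⟩ := Metric.cauchySeq_iff'.1 hlim.cauchySeq ε hε
    refine ⟨N, fun n hn => lt_of_le_of_lt ?_ (hN n hn)⟩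
    rw [dist_eq_norm, dist_eq_norm]
    exact hdist n N E hE
  choose! m hm using hcau
  obtain ⟨μ, hμ⟩ := exists_vectorMeasure_of_uniform_limit (ν := ν) (m := m)
    (b := fun n => ‖f n - φ‖) (tendsto_iff_norm_sub_tendsto_zero.1 hlim) fun n E hE =>
      le_of_tendsto_of_tendsto' ((tendsto_const_nhds.sub (hm E hE)).norm)
        ((tendsto_const_nhds.sub hlim).norm) fun k => hdist n k E hE
  refine ⟨μ, fun j => ?_⟩
  rw [hμ _ (hs j)]
  refine tendsto_nhds_unique (hm _ (hs j)) ?_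
  simp only [hν]
  exact ((L j).continuous.tendsto _).comp hlim

end Approximation

/-! ### Product measures of positive operator-valued measures -/

section POVM

universe u v

section Single

variable {X : Type v} [MeasurableSpace X] {E : Type u} [NormedAddCommGroup E]
  [InnerProductSpace ℂ E] (M : POVM X E)

theorem POVM.empty_eq (x y : E) : ⟪x, M.toFun ∅ y⟫_ℂ = 0 := by
  have h := M.hasSum_iUnion (fun _ => ∅) (fun _ => MeasurableSet.empty)
    (fun _ _ _ => Set.disjoint_empty _) x y
  rw [Set.iUnion_empty] at h
  exact (summable_const_iff _).1 h.summable

theorem POVM.re_inner_nonneg {F : Set X} (hF : MeasurableSet F) (x : E) :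
    0 ≤ (⟪x, M.toFun F x⟫_ℂ).re :=
  (M.isPositive F hF).re_inner_nonneg_right x

theorem POVM.ofReal_re_inner {F : Set X} (hF : MeasurableSet F) (x : E) :
    (((⟪x, M.toFun F x⟫_ℂ).re : ℝ) : ℂ) = ⟪x, M.toFun F x⟫_ℂ := by
  have h := (M.isPositive F hF).inner_nonneg_right x
  rw [Complex.nonneg_iff] at h
  exact Complex.ext rfl (by simpa using h.2)

/-- The measure `F ↦ ⟪x, M(F) x⟫`. -/
def POVM.quadMeasure (x : E) : Measure X :=
  Measure.ofMeasurable (fun F _ => ENNReal.ofReal (⟪x, M.toFun F x⟫_ℂ).re)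
    (by simp [M.empty_eq]) fun f hf hd => by
      have h := Complex.reCLM.hasSum (M.hasSum_iUnion f hf hd x x)
      rw [← ENNReal.ofReal_tsum_of_nonneg (fun i => M.re_inner_nonneg (hf i) x) h.summable]
      exact congrArg _ h.tsum_eq.symm

theorem POVM.quadMeasure_apply (x : E) {F : Set X} (hF : MeasurableSet F) :
    M.quadMeasure x F = ENNReal.ofReal (⟪x, M.toFun F x⟫_ℂ).re :=
  Measure.ofMeasurable_apply F hF

instance (x : E) : IsFiniteMeasure (M.quadMeasure x) :=
  ⟨by rw [M.quadMeasure_apply x MeasurableSet.univ]; exact ENNReal.ofReal_lt_top⟩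

theorem POVM.quadMeasure_real (x : E) {F : Set X} (hF : MeasurableSet F) :
    (((M.quadMeasure x).real F : ℝ) : ℂ) = ⟪x, M.toFun F x⟫_ℂ := by
  rw [← M.ofReal_re_inner hF, measureReal_def, M.quadMeasure_apply x hF,
    ENNReal.toReal_ofReal (M.re_inner_nonneg hF x)]

theorem inner_polarization_sum (T : E →L[ℂ] E) (x y : E) :
    ⟪x, T y⟫_ℂ = ∑ k : Fin 4, ((-Complex.I) ^ (k : ℕ) / 4) *
      ⟪x + Complex.I ^ (k : ℕ) • y, T (x + Complex.I ^ (k : ℕ) • y)⟫_ℂ := by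
  have h3 : Complex.I ^ 3 = -Complex.I := by
    rw [pow_succ, Complex.I_sq]
    ring
  simp only [Fin.sum_univ_four, map_add, map_smul, inner_add_left, inner_add_right,
    inner_smul_left, inner_smul_right, Fin.val_zero, Fin.val_one, Fin.val_two,
    show ((3 : Fin 4) : ℕ) = 3 from rfl, pow_zero, pow_one, neg_pow Complex.I 3, h3,
    neg_sq, Complex.I_sq, map_one, map_neg, Complex.conj_I]
  linear_combination (⟪x, T y⟫_ℂ / 2 - ⟪y, T x⟫_ℂ / 2) * Complex.I_sq

end Single

variable {ι : Type*} [Fintype ι] {Λ : ι → Type v} [∀ i, MeasurableSpace (Λ i)]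
  {H : ι → Type u} [∀ i, NormedAddCommGroup (H i)] [∀ i, InnerProductSpace ℂ (H i)]

/-- `ν` is the complex measure `φ (⨂ i, M i (dλ i))`. -/
def IsProductMeasure (M : ∀ i, POVM (Λ i) (H i))
    (φ : (HilbertTensor H →L[ℂ] HilbertTensor H) →L[ℂ] ℂ) (ν : VectorMeasure (∀ i, Λ i) ℂ) : Prop :=
  ∀ F : ∀ i, Set (Λ i), (∀ i, MeasurableSet (F i)) →
    ν (Set.univ.pi F) = φ (tensorMap fun i => (M i).toFun (F i))

variable {M : ∀ i, POVM (Λ i) (H i)} {φ ψ : (HilbertTensor H →L[ℂ] HilbertTensor H) →L[ℂ] ℂ}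
  {μ ν : VectorMeasure (∀ i, Λ i) ℂ}

theorem IsProductMeasure.add (h₁ : IsProductMeasure M φ μ) (h₂ : IsProductMeasure M ψ ν) :
    IsProductMeasure M (φ + ψ) (μ + ν) := fun F hF => by
  simp [h₁ F hF, h₂ F hF]

theorem IsProductMeasure.smul (c : ℂ) (h : IsProductMeasure M φ μ) :
    IsProductMeasure M (c • φ) (c • μ) := fun F hF => by
  simp [h F hF]

theorem exists_isProductMeasure_simpleTensor (M : ∀ i, POVM (Λ i) (H i)) (x y : ∀ i, H i) :
    ∃ ν, IsProductMeasure M (vecFunctional (simpleTensor x) (simpleTensor y)) ν := by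
  classical
  -- One of the four polarization phases is chosen at every index; the coefficients below appear
  -- when the product of the polarization sums is expanded.
  let m : (ι → Fin 4) → Measure (∀ i, Λ i) := fun κ =>
    Measure.pi fun i => (M i).quadMeasure (x i + Complex.I ^ (κ i : ℕ) • y i)
  refine ⟨∑ κ : ι → Fin 4, (∏ i, ((-Complex.I) ^ (κ i : ℕ) / 4)) •
    ((m κ).toSignedMeasure.mapRange Complex.ofRealHom.toAddMonoidHom Complex.continuous_ofReal),
    fun F hF => ?_⟩
  rw [vecFunctional_apply, inner_tensorMap_simpleTensor]
  simp only [fun i => inner_polarization_sum ((M i).toFun (F i)) (x i) (y i)]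
  rw [Finset.prod_univ_sum, Fintype.piFinset_univ, sum_apply]
  refine Finset.sum_congr rfl fun κ _ => ?_
  rw [Finset.prod_mul_distrib, smul_apply, smul_eq_mul,
    VectorMeasure.mapRange_apply,
    Measure.toSignedMeasure_apply_measurable (MeasurableSet.univ_pi hF), measureReal_def,
    Measure.pi_pi, ENNReal.toReal_prod]
  congr 1
  change Complex.ofReal _ = _
  rw [Complex.ofReal_prod]
  exact Finset.prod_congr rfl fun i _ => (M i).quadMeasure_real _ (hF i)

variable [∀ i, CompleteSpace (H i)]

theorem exists_operator_of_mem_boxes (M : ∀ i, POVM (Λ i) (H i)) {R : Set (∀ i, Λ i)}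
    (hR : R ∈ boxes Λ) : ∃ A : HilbertTensor H →L[ℂ] HilbertTensor H, 0 ≤ A ∧
      ∀ φ ν, IsProductMeasure M φ ν → ν R = φ A := by
  rcases boxes_cases hR with rfl | ⟨F, hF, rfl⟩
  · exact ⟨0, le_rfl, fun φ ν _ => by simp⟩
  · exact ⟨_, tensorMap_nonneg fun i =>
      (ContinuousLinearMap.nonneg_iff_isPositive _).2 ((M i).isPositive _ (hF i)),
      fun φ ν h => h F hF⟩

/-- A finite union of boxes is a disjoint finite union of boxes, and the positive operators of the
pieces are added. The operator is the same for all `φ`. -/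
theorem exists_nonneg_operator_of_mem_supClosure (M : ∀ i, POVM (Λ i) (H i))
    {t : Set (∀ i, Λ i)} (ht : t ∈ supClosure (boxes Λ)) :
    ∃ A : HilbertTensor H →L[ℂ] HilbertTensor H, 0 ≤ A ∧
      ∀ φ ν, IsProductMeasure M φ ν → ν t = φ A := by
  classical
  obtain ⟨P, hP⟩ := isSetSemiring_boxes.mem_supClosure_iff.1 ht
  choose! A hA hA' using fun R (hR : R ∈ boxes Λ) => exists_operator_of_mem_boxes M hR
  refine ⟨∑ R ∈ P.parts, A R, Finset.sum_nonneg fun R hR => hA R (hP hR), fun φ ν h => ?_⟩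
  have e : ν t = ν (⋃ R ∈ P.parts, id R) := by rw [← Finset.sup_set_eq_biUnion, P.sup_parts]
  rw [map_sum, e, VectorMeasure.of_biUnion_finset P.disjoint
    fun R hR => measurableSet_of_mem_boxes (hP hR)]
  exact Finset.sum_congr rfl fun R hR => hA' R (hP hR) φ ν h

/-- The values of all measures `φ (⨂ i, M i (dλ i))` on a finite union of rectangles are given by
one operator between `0` and `1`. -/
theorem exists_operator_of_mem_supClosure (M : ∀ i, POVM (Λ i) (H i))
    {t : Set (∀ i, Λ i)} (ht : t ∈ supClosure (boxes Λ)) :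
    ∃ A : HilbertTensor H →L[ℂ] HilbertTensor H, 0 ≤ A ∧ ‖A‖ ≤ 1 ∧
      ∀ φ ν, IsProductMeasure M φ ν → ν t = φ A := by
  obtain ⟨A, hA, hA'⟩ := exists_nonneg_operator_of_mem_supClosure M ht
  obtain ⟨B, hB, hB'⟩ := exists_nonneg_operator_of_mem_supClosure M
    (isSetSemiring_boxes.isSetRing_supClosure.sdiff_mem (subset_supClosure univ_mem_boxes) ht)
  have htm : MeasurableSet t := by
    have h : MeasurableSet[.generateFrom (boxes Λ)] t :=
      measurableSet_generateFrom_of_mem_supClosure ht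
    rwa [← generateFrom_boxes] at h
  -- The set and its complement make up the whole space, whose operator is `1`. Vector functionals
  -- at simple tensors already have product measures, and they separate operators.
  have e : A + B = 1 := hilbertTensor_op_ext fun x y => by
    obtain ⟨ν, hν⟩ := exists_isProductMeasure_simpleTensor M x y
    have h1 := hA' _ _ hν
    have h2 := hB' _ _ hν
    have h3 := hν (fun _ => Set.univ) fun _ => MeasurableSet.univ
    have h4 := ν.of_add_of_sdiff htm MeasurableSet.univ (Set.subset_univ t)
    simp only [POVM.univ_eq_one, tensorMap_one, Set.pi_univ] at h3
    rw [h1, h2, h3] at h4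
    simpa only [vecFunctional_apply, add_apply, inner_add_right] using h4
  refine ⟨A, hA, ?_, hA'⟩
  rw [CStarAlgebra.norm_le_one_iff_of_nonneg A hA, ← e]
  exact le_add_of_nonneg_right hB

theorem IsProductMeasure.norm_le (h : IsProductMeasure M φ ν) {E : Set (∀ i, Λ i)}
    (hE : MeasurableSet E) : ‖ν E‖ ≤ ‖φ‖ := by
  refine le_of_forall_pos_le_add fun ε hε => ?_
  obtain ⟨t, ht, hlt⟩ := exists_mem_supClosure_norm_sub_lt isSetSemiring_boxes univ_mem_boxes
    generateFrom_boxes ν hE hε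
  obtain ⟨A, -, hA1, hA⟩ := exists_operator_of_mem_supClosure M ht
  have h1 : ‖ν t‖ ≤ ‖φ‖ := by
    rw [hA φ ν h]
    exact φ.le_of_opNorm_le_of_le le_rfl hA1 |>.trans_eq (mul_one _)
  have h2 := norm_le_norm_add_norm_sub' (ν E) (ν t)
  linarith

/-- The norm bound `IsProductMeasure.norm_le` needs a measure to be given already; applied to
differences it shows that the representable functionals form a closed subspace, which then contains
all normal ones. -/
theorem exists_isProductMeasure (M : ∀ i, POVM (Λ i) (H i))
    (hφ : φ ∈ normalFunctionals (HilbertTensor H)) : ∃ ν, IsProductMeasure M φ ν := by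
  let C : Submodule ℂ ((HilbertTensor H →L[ℂ] HilbertTensor H) →L[ℂ] ℂ) :=
    { carrier := {φ | ∃ ν, IsProductMeasure M φ ν}
      add_mem' := fun ⟨μ, h₁⟩ ⟨ν, h₂⟩ => ⟨μ + ν, h₁.add h₂⟩
      zero_mem' := ⟨0, fun F _ => by simp⟩
      smul_mem' := fun c _ ⟨ν, h⟩ => ⟨c • ν, h.smul c⟩ }
  refine normal_mem_of_simpleTensor (C := C) ?_ (exists_isProductMeasure_simpleTensor M) hφ
  let F' := {F : ∀ i, Set (Λ i) // ∀ i, MeasurableSet (F i)}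
  let L : F' → ((HilbertTensor H →L[ℂ] HilbertTensor H) →L[ℂ] ℂ) →L[ℂ] ℂ := fun F =>
    ContinuousLinearMap.apply ℂ ℂ (tensorMap fun i => (M i).toFun (F.1 i))
  have e : (C : Set ((HilbertTensor H →L[ℂ] HilbertTensor H) →L[ℂ] ℂ)) =
      {φ | ∃ ν : VectorMeasure (∀ i, Λ i) ℂ, ∀ F : F', ν (Set.univ.pi F.1) = L F φ} :=
    Set.ext fun φ => exists_congr fun ν => ⟨fun h F => h F.1 F.2, fun h F hF => h ⟨F, hF⟩⟩
  rw [e]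
  exact isClosed_setOf_exists_vectorMeasure
    (V := (HilbertTensor H →L[ℂ] HilbertTensor H) →L[ℂ] ℂ) (J := F')
    (s := fun F => Set.univ.pi F.1) (fun F => MeasurableSet.univ_pi F.2) L
    fun φ ν h E hE => IsProductMeasure.norm_le (M := M) (fun F hF => h ⟨F, hF⟩) hE

/-- The real-valued measure `φ (⨂ i, M i (dλ i))` of a hermitian normal functional. -/
theorem exists_signedMeasure (M : ∀ i, POVM (Λ i) (H i))
    (hφ : φ ∈ normalFunctionals (HilbertTensor H))
    (hherm : ∀ Y : HilbertTensor H →L[ℂ] HilbertTensor H,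
      φ Y.adjoint = (starRingEnd ℂ) (φ Y)) :
    ∃ μ : SignedMeasure (∀ i, Λ i), ∀ F : ∀ i, Set (Λ i), (∀ i, MeasurableSet (F i)) →
      ((μ (Set.univ.pi F) : ℝ) : ℂ) = φ (tensorMap fun i => (M i).toFun (F i)) := by
  obtain ⟨ν, hν⟩ := exists_isProductMeasure M hφ
  refine ⟨ν.mapRange Complex.reAddGroupHom Complex.continuous_re,
    fun F hF => ?_⟩
  have h1 : (tensorMap fun i => (M i).toFun (F i)).adjoint =
      tensorMap fun i => (M i).toFun (F i) := by
    rw [adjoint_tensorMap]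
    congr 1
    ext1 i
    exact ((M i).isPositive _ (hF i)).isSelfAdjoint.adjoint_eq
  have h2 := hherm (tensorMap fun i => (M i).toFun (F i))
  rw [h1] at h2
  change (((ν (Set.univ.pi F)).re : ℝ) : ℂ) = _
  rw [hν F hF]
  exact Complex.conj_eq_iff_re.1 h2.symm

/-- The measure `φ (⨂ i, M i (dλ i))` of a positive normal functional. -/
theorem exists_measure (M : ∀ i, POVM (Λ i) (H i))
    (hφ : φ ∈ normalFunctionals (HilbertTensor H))
    (hpos : ∀ Y : HilbertTensor H →L[ℂ] HilbertTensor H, 0 ≤ Y → 0 ≤ φ Y) :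
    ∃ P : Measure (∀ i, Λ i), IsFiniteMeasure P ∧
      ∀ F : ∀ i, Set (Λ i), (∀ i, MeasurableSet (F i)) →
        ((P.real (Set.univ.pi F) : ℝ) : ℂ) = φ (tensorMap fun i => (M i).toFun (F i)) := by
  obtain ⟨ν, hν⟩ := exists_isProductMeasure M hφ
  have hν0 : ∀ E, MeasurableSet E → 0 ≤ ν E := fun E hE => by
    -- Values on finite unions of boxes are `φ A` with `0 ≤ A`, and they approximate `ν E`.
    have h1 : ν E ∈ closure {z : ℂ | 0 ≤ z} := Metric.mem_closure_iff.2 fun ε hε => by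
      obtain ⟨t, ht, hlt⟩ := exists_mem_supClosure_norm_sub_lt isSetSemiring_boxes univ_mem_boxes
        generateFrom_boxes ν hE hε
      obtain ⟨A, hA0, -, hA⟩ := exists_operator_of_mem_supClosure M ht
      exact ⟨ν t, by rw [Set.mem_ofPred_eq, hA φ ν hν]; exact hpos A hA0, by rwa [dist_eq_norm]⟩
    exact (isClosed_Ici (a := (0 : ℂ))).closure_subset h1
  let r : SignedMeasure (∀ i, Λ i) :=
    ν.mapRange Complex.reAddGroupHom Complex.continuous_re
  have hr : 0 ≤[Set.univ] r := by
    rw [VectorMeasure.le_restrict_univ_iff_le]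
    intro E hE
    exact (Complex.nonneg_iff.1 (hν0 E hE)).1
  refine ⟨r.toMeasureOfZeroLE Set.univ MeasurableSet.univ hr, inferInstance, fun F hF => ?_⟩
  have hm := MeasurableSet.univ_pi hF
  have h1 := congrArg (fun s : SignedMeasure _ => s (Set.univ.pi F))
    (r.toMeasureOfZeroLE_toSignedMeasure hr)
  rw [Measure.toSignedMeasure_apply_measurable hm] at h1
  rw [h1, ← hν F hF]
  exact Complex.ext rfl (Complex.nonneg_iff.1 (hν0 _ hm)).2

end POVM

/-! ### Source operators -/

section Source

universe u

variable {N : ℕ} {S : Fin N → ℕ} {H : Fin N → Type u} [∀ n, NormedAddCommGroup (H n)]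
  [∀ n, InnerProductSpace ℂ (H n)]

/-- The vectors `x n` on the copies chosen by `a`, and `e n` on all other copies. -/
def placedVec (e : ∀ n, H n) (a : ∀ n, Option (Fin (S n))) (x : ∀ n, H n) :
    ∀ p : Σ n, Fin (S n), H p.1 :=
  fun p => if a p.1 = some p.2 then x p.1 else e p.1

/-- The vectors `x n` at the sites where `a` chooses no copy, and `e n` at all other sites. -/
def unplacedVec (e : ∀ n, H n) (a : ∀ n, Option (Fin (S n))) (x : ∀ n, H n) : ∀ n, H n :=
  fun n => if a n = none then x n else e n

/-- At each site the vector `x n` sits either on one copy or in the second tensor, and all slots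
holding `e n` contribute `1` unless `X n` acts on them. -/
theorem prod_inner_placedVec {e : ∀ n, H n} (he : ∀ n, ‖e n‖ = 1) (a : ∀ n, Option (Fin (S n)))
    (k : ∀ n, Fin (S n)) (X : ∀ n, H n →L[ℂ] H n) (x y : ∀ n, H n) :
    (∏ p : Σ n, Fin (S n), ⟪placedVec e a x p,
        (if p.2 = k p.1 then X p.1 else 1 : H p.1 →L[ℂ] H p.1) (placedVec e a y p)⟫_ℂ) *
      ∏ n, ⟪unplacedVec e a x n, unplacedVec e a y n⟫_ℂ =
    ∏ n, if a n = some (k n) then ⟪x n, X n (y n)⟫_ℂ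
      else ⟪e n, X n (e n)⟫_ℂ * ⟪x n, y n⟫_ℂ := by
  rw [Fintype.prod_sigma, ← Finset.prod_mul_distrib]
  refine Finset.prod_congr rfl fun n _ => ?_
  simp only [placedVec, unplacedVec]
  rcases h : a n with _ | j₀
  · have e1 : ∀ j : Fin (S n), ⟪(if (none : Option (Fin (S n))) = some j then x n else e n),
        (if j = k n then X n else 1 : H n →L[ℂ] H n)
          (if (none : Option (Fin (S n))) = some j then y n else e n)⟫_ℂ =
        if j = k n then ⟪e n, X n (e n)⟫_ℂ else 1 := fun j => by
      by_cases hj : j = k n <;> simp [hj, he]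
    simp only [e1, Fintype.prod_ite_eq']
    simp
  · have e1 : ∀ j : Fin (S n), ⟪(if some j₀ = some j then x n else e n),
        (if j = k n then X n else 1 : H n →L[ℂ] H n) (if some j₀ = some j then y n else e n)⟫_ℂ =
        (if j = j₀ then (if j₀ = k n then ⟪x n, X n (y n)⟫_ℂ else ⟪x n, y n⟫_ℂ) else 1) *
        (if j = k n then (if j₀ = k n then 1 else ⟪e n, X n (e n)⟫_ℂ) else 1) := fun j => by
      by_cases h1 : j = j₀
      · subst h1
        by_cases h2 : j = k n <;> simp [h2]
      · have h1' : j₀ ≠ j := fun h => h1 h.symm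
        by_cases h2 : j = k n
        · have h3 : j₀ ≠ k n := fun h => h1' (h.trans h2.symm)
          subst h2
          simp [h1, h3]
        · simp [h1, h1', h2, he]
    simp only [e1, Finset.prod_mul_distrib, Fintype.prod_ite_eq']
    by_cases h2 : j₀ = k n <;> simp [h2, he, mul_comm]

/-- Here `R Y = J* (Y ⊗ 1) J`, where `J` sends a simple tensor to its placed part tensor its
unplaced part. Composing a functional with `R` places the chosen factors on copies and traces out
the rest. -/
theorem exists_reduction [∀ n, CompleteSpace (H n)] {e : ∀ n, H n} (he : ∀ n, ‖e n‖ = 1)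
    (hS : ∀ n, 1 ≤ S n) (a : ∀ n, Option (Fin (S n))) :
    ∃ R : (SourceSpace S H →L[ℂ] SourceSpace S H) →L[ℂ] (HilbertTensor H →L[ℂ] HilbertTensor H),
      (∀ Y, (R Y).adjoint = R Y.adjoint) ∧
      ∀ Y x y, ⟪simpleTensor x, R Y (simpleTensor y)⟫_ℂ =
        ⟪simpleTensor (placedVec e a x), Y (simpleTensor (placedVec e a y))⟫_ℂ *
          ⟪simpleTensor (unplacedVec e a x), simpleTensor (unplacedVec e a y)⟫_ℂ := by
  obtain ⟨J, hJ⟩ := exists_lift_of_inner (H := H)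
    (E := HilbertTensor (Pair (SourceSpace S H) (HilbertTensor H)))
    (fun x => simpleTensor (pairVec (simpleTensor (placedVec e a x))
      (simpleTensor (unplacedVec e a x)))) fun x y => by
      -- With `X = 1` the observed copy is irrelevant; copy `0` exists because `1 ≤ S n`.
      have h := prod_inner_placedVec he a (fun n => ⟨0, hS n⟩) (fun n => 1) x y
      simp only [ite_self, one_apply_eq_self, inner_self_eq_norm_sq_to_K, he] at h
      rw [inner_pairVec, inner_simpleTensor, inner_simpleTensor, h]
      simp
  let R : (SourceSpace S H →L[ℂ] SourceSpace S H) →L[ℂ]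
      (HilbertTensor H →L[ℂ] HilbertTensor H) :=
    J.adjoint.postcomp (HilbertTensor H) ∘L J.precomp _ ∘L
      amplification (SourceSpace S H) (HilbertTensor H)
  have hR : ∀ Y, R Y = J.adjoint ∘L amplification (SourceSpace S H) (HilbertTensor H) Y ∘L J :=
    fun Y => rfl
  refine ⟨R, fun Y => ?_, fun Y x y => ?_⟩
  · rw [hR, hR, ContinuousLinearMap.adjoint_comp, ContinuousLinearMap.adjoint_comp,
      ContinuousLinearMap.adjoint_adjoint, adjoint_amplification, ContinuousLinearMap.comp_assoc]
  · rw [hR, ContinuousLinearMap.comp_apply, ContinuousLinearMap.adjoint_inner_right,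
      ContinuousLinearMap.comp_apply, hJ, hJ, inner_amplification]

theorem exists_norm_eq_one_of_state {ρ : HilbertTensor H →L[ℂ] HilbertTensor H}
    (hρ : trace ρ = 1) : ∃ e : ∀ n, H n, ∀ n, ‖e n‖ = 1 := by
  have h : ∀ n, ∃ e : H n, ‖e‖ = 1 := fun n => by
    rcases subsingleton_or_nontrivial (H n) with hs | hs
    · have h0 : ∀ x : ∀ n, H n, simpleTensor x = 0 := fun x => by
        rw [← @inner_self_eq_zero ℂ, inner_simpleTensor]
        exact Finset.prod_eq_zero (Finset.mem_univ n) (by simp [Subsingleton.elim (x n) 0])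
      have h1 : ρ = 0 := hilbertTensor_hom_ext fun x => by simp [h0]
      simp [h1, trace] at hρ
    · exact exists_norm_eq _ zero_le_one
  choose e he using h
  exact ⟨e, he⟩

/-- This is the cancellation at one site: `v` occurs `s - 1` times among the placements, and the
weight `1 - s` of `none` removes it. -/
theorem sum_option_fin {s : ℕ} (k : Fin s) (u v : ℂ) :
    ∑ o : Option (Fin s), (if o = none then 1 - (s : ℂ) else 1) *
      (if o = some k then u else v) = u := by
  have h : ∀ j : Fin s, (if (some j : Option (Fin s)) = some k then u else v) =
      v + if j = k then u - v else 0 := fun j => by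
    by_cases hj : j = k <;> simp [hj]
  rw [Fintype.sum_option]
  simp only [h]
  simp [Finset.sum_add_distrib]
  ring

/-- Every state has a source operator. -/
theorem exists_isSourceOperator [∀ n, CompleteSpace (H n)]
    {ρ : HilbertTensor H →L[ℂ] HilbertTensor H} (hρ : IsState ρ) (hS : ∀ n, 1 ≤ S n) :
    ∃ T : SourceSpace S H →L[ℂ] SourceSpace S H, IsSourceOperator ρ T := by
  obtain ⟨e, he⟩ := exists_norm_eq_one_of_state hρ.trace_eq_one
  obtain ⟨φ, hφ, hφρ⟩ := exists_normal_eq_trace hρ.pos.isSelfAdjoint hρ.traceClass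
  have hherm := map_adjoint_of_hasSum hρ.pos.isSelfAdjoint hφ hφρ
  choose R hRadj hR using exists_reduction (S := S) he hS
  let c : (∀ n, Option (Fin (S n))) → ℝ := fun a => ∏ n, if a n = none then 1 - (S n : ℝ) else 1
  let ψ : (SourceSpace S H →L[ℂ] SourceSpace S H) →L[ℂ] ℂ := ∑ a, (c a : ℂ) • (φ ∘L R a)
  have hψa : ∀ Y, ψ Y = ∑ a, (c a : ℂ) * φ (R a Y) := fun Y => by simp [ψ]
  have hψ : ψ ∈ normalFunctionals (SourceSpace S H) := by
    refine Submodule.sum_mem _ fun a _ => Submodule.smul_mem _ _ ?_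
    let D : ((HilbertTensor H →L[ℂ] HilbertTensor H) →L[ℂ] ℂ) →L[ℂ]
        ((SourceSpace S H →L[ℂ] SourceSpace S H) →L[ℂ] ℂ) :=
      (R a).precomp ℂ
    refine normal_mem_of_simpleTensor
      (C := (normalFunctionals (SourceSpace S H)).comap D.toLinearMap)
      (isClosed_normalFunctionals.preimage D.continuous) (fun x y => ?_) hφ
    have e1 : D (vecFunctional (simpleTensor x) (simpleTensor y)) =
        ⟪simpleTensor (unplacedVec e a x), simpleTensor (unplacedVec e a y)⟫_ℂ •
          vecFunctional (simpleTensor (placedVec e a x)) (simpleTensor (placedVec e a y)) := by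
      ext Y
      exact (hR a Y x y).trans (mul_comm _ _)
    rw [Submodule.mem_comap, ContinuousLinearMap.coe_coe, e1]
    exact Submodule.smul_mem _ _ (vecFunctional_mem _ _)
  have hψherm : ∀ u v, ψ (rankOne ℂ u v) = (starRingEnd ℂ) (ψ (rankOne ℂ v u)) := fun u v => by
    rw [hψa, hψa, map_sum]
    refine Finset.sum_congr rfl fun a _ => ?_
    rw [map_mul, Complex.conj_ofReal, ← hherm, hRadj, adjoint_rankOne]
  refine ⟨densityOperator ψ, isSelfAdjoint_densityOperator hψherm,
    isTraceClass_densityOperator hψherm, fun k X => ?_⟩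
  rw [trace_densityOperator_mul hψ, hψa]
  have e2 : ∑ a, (c a : ℂ) • R a (tensorMap fun p : Σ n, Fin (S n) =>
      if p.2 = k p.1 then X p.1 else 1) = tensorMap X := hilbertTensor_op_ext fun x y => by
    rw [sum_apply, inner_sum]
    simp only [smul_apply, inner_smul_right, hR, inner_tensorMap_simpleTensor, inner_simpleTensor,
      prod_inner_placedVec he, c, Complex.ofReal_prod, ← Finset.prod_mul_distrib]
    -- The weights are products over the sites, so the sum over all placements is a product of
    -- one-site sums.
    rw [← Fintype.piFinset_univ, ← Finset.prod_univ_sum (fun _ => Finset.univ)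
      (fun n (o : Option (Fin (S n))) => ((if o = none then 1 - (S n : ℝ) else 1 : ℝ) : ℂ) *
        if o = some (k n) then ⟪x n, X n (y n)⟫_ℂ else ⟪e n, X n (e n)⟫_ℂ * ⟪x n, y n⟫_ℂ)]
    refine Finset.prod_congr rfl fun n _ => ?_
    simpa using sum_option_fin (k n) ⟪x n, X n (y n)⟫_ℂ (⟪e n, X n (e n)⟫_ℂ * ⟪x n, y n⟫_ℂ)
  have e3 : ∑ a, (c a : ℂ) * φ (R a (tensorMap fun p : Σ n, Fin (S n) =>
      if p.2 = k p.1 then X p.1 else 1)) = φ (tensorMap X) := by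
    rw [← e2, map_sum]
    exact Finset.sum_congr rfl fun a _ => by rw [map_smul, smul_eq_mul]
  rw [e3, ← (hφρ _).tsum_eq]
  rfl

end Source

/-! ### Correlation scenarios -/

section Scenario

universe u v

variable {N : ℕ} {S : Fin N → ℕ} {Λ : Fin N → Type v} [∀ n, MeasurableSpace (Λ n)]
  {H : Fin N → Type u} [∀ n, NormedAddCommGroup (H n)] [∀ n, InnerProductSpace ℂ (H n)]

theorem isNormalizedBounded_of_univ {X : Type*} [MeasurableSpace X] {μ : SignedMeasure X}
    (h : μ Set.univ = 1) : IsNormalizedBounded μ :=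
  ⟨h, μ.bound, fun F _ => by simpa using μ.norm_apply_le_bound (s := F)⟩

theorem integral_indicator_one {X : Type*} [MeasurableSpace X] (μ : SignedMeasure X) {A : Set X}
    (hA : MeasurableSet A) : ∫ᵛ ω, A.indicator (fun _ => (1 : ℝ)) ω ∂<•μ = μ A := by
  have : IsFiniteMeasure (μ.restrict A).variation := by
    rw [← SignedMeasure.totalVariation_eq_variation]
    infer_instance
  rw [VectorMeasure.integral_indicator hA, VectorMeasure.integral_const]
  simp

theorem IsQuantumScenario.eq {ρ : HilbertTensor H →L[ℂ] HilbertTensor H}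
    {M : ∀ n, Fin (S n) → POVM (Λ n) (H n)} {P Q : (∀ n, Fin (S n)) → Measure (∀ n, Λ n)}
    (hP : IsQuantumScenario ρ M P) (hQ : IsQuantumScenario ρ M Q) : P = Q := by
  funext s
  have := hP.isProbabilityMeasure s
  have := hQ.isProbabilityMeasure s
  rw [← Measure.toSignedMeasure_eq_toSignedMeasure_iff]
  refine vectorMeasure_ext_boxes fun F hF => ?_
  have hm := MeasurableSet.univ_pi hF
  rw [Measure.toSignedMeasure_apply_measurable hm, Measure.toSignedMeasure_apply_measurable hm]
  exact Complex.ofReal_injective ((hP.apply_pi s F hF).trans (hQ.apply_pi s F hF).symm)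

variable [∀ n, CompleteSpace (H n)]

theorem exists_isQuantumScenario {ρ : HilbertTensor H →L[ℂ] HilbertTensor H} (hρ : IsState ρ)
    (M : ∀ n, Fin (S n) → POVM (Λ n) (H n)) :
    ∃ P : (∀ n, Fin (S n)) → Measure (∀ n, Λ n), IsQuantumScenario ρ M P := by
  obtain ⟨φ, hφ, h⟩ := exists_normal_eq_trace hρ.pos.isSelfAdjoint hρ.traceClass
  have htr : ∀ Y, φ Y = trace (ρ * Y) := fun Y => (h Y).tsum_eq.symm
  choose P hfin hP using fun s : ∀ n, Fin (S n) => exists_measure (fun n => M n (s n)) hφ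
    fun Y hY => map_nonneg_of_hasSum hρ.pos hφ h hY
  refine ⟨P, fun s => ⟨?_⟩, fun s F hF => by rw [hP s F hF, htr]⟩
  have h1 := hP s (fun _ => Set.univ) fun _ => MeasurableSet.univ
  simp only [POVM.univ_eq_one, tensorMap_one, htr, mul_one, hρ.trace_eq_one, Set.pi_univ,
    Complex.ofReal_eq_one] at h1
  have := hfin s
  rwa [measureReal_def, ENNReal.toReal_eq_one_iff] at h1

theorem exists_isSourceMeasure {T : SourceSpace S H →L[ℂ] SourceSpace S H}
    (hT : IsSelfAdjoint T) (htc : IsTraceClass T) (M : ∀ n, Fin (S n) → POVM (Λ n) (H n)) :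
    ∃ μ : SignedMeasure (∀ n, Fin (S n) → Λ n), IsSourceMeasure T M μ := by
  obtain ⟨φ, hφ, h⟩ := exists_normal_eq_trace hT htc
  -- Every copy `(n, j)` counts as a tensor factor with its own outcome space; currying then
  -- regroups the coordinates by site.
  obtain ⟨μ, hμ⟩ := exists_signedMeasure (Λ := fun p : Σ n, Fin (S n) => Λ p.1)
    (fun p : Σ n, Fin (S n) => M p.1 p.2) hφ (map_adjoint_of_hasSum hT hφ h)
  refine ⟨μ.map (MeasurableEquiv.piCurry fun n (_ : Fin (S n)) => Λ n), fun F hF => ?_⟩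
  have hset : {l : ∀ n, Fin (S n) → Λ n | ∀ n j, l n j ∈ F n j} =
      Set.univ.pi fun n => Set.univ.pi (F n) := by
    ext l
    simp
  have hpre : (MeasurableEquiv.piCurry fun n (_ : Fin (S n)) => Λ n) ⁻¹'
      {l : ∀ n, Fin (S n) → Λ n | ∀ n j, l n j ∈ F n j} =
      Set.univ.pi fun p : Σ n, Fin (S n) => F p.1 p.2 := by
    ext l
    simp only [Set.mem_univ_pi, Sigma.forall]
    rfl
  have hm : MeasurableSet {l : ∀ n, Fin (S n) → Λ n | ∀ n j, l n j ∈ F n j} := by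
    rw [hset]
    exact MeasurableSet.univ_pi fun n => MeasurableSet.univ_pi (hF n)
  rw [VectorMeasure.map_apply _ (MeasurableEquiv.measurable _) hm, hpre,
    hμ _ fun p => hF p.1 p.2]
  exact (h _).tsum_eq.symm

omit [∀ n, CompleteSpace (H n)] in
/-- The marginals of the measure of a source operator are the distributions of the scenario. -/
theorem IsSourceMeasure.marginal_eq {ρ : HilbertTensor H →L[ℂ] HilbertTensor H}
    {T : SourceSpace S H →L[ℂ] SourceSpace S H} {M : ∀ n, Fin (S n) → POVM (Λ n) (H n)}
    {P : (∀ n, Fin (S n)) → Measure (∀ n, Λ n)} {μ : SignedMeasure (∀ n, Fin (S n) → Λ n)}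
    (hμ : IsSourceMeasure T M μ) (hT : IsSourceOperator ρ T) (hP : IsQuantumScenario ρ M P)
    (s : ∀ n, Fin (S n)) {E : Set (∀ n, Λ n)} (hE : MeasurableSet E) :
    μ {l | (fun n => l n (s n)) ∈ E} = (P s).real E := by
  have := hP.isProbabilityMeasure s
  have hf : Measurable fun (l : ∀ n, Fin (S n) → Λ n) n => l n (s n) :=
    measurable_pi_lambda _ fun n => (measurable_pi_apply (s n)).comp (measurable_pi_apply n)
  have key : μ.map (fun (l : ∀ n, Fin (S n) → Λ n) n => l n (s n)) = (P s).toSignedMeasure := by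
    refine vectorMeasure_ext_boxes fun F hF => ?_
    have hm := MeasurableSet.univ_pi hF
    rw [VectorMeasure.map_apply _ hf hm, Measure.toSignedMeasure_apply_measurable hm]
    -- The cylinder over a box is a box with full sides at the other copies, where the POVM gives
    -- `1`; this is the operator pattern in the source operator identity.
    have hset : (fun (l : ∀ n, Fin (S n) → Λ n) n => l n (s n)) ⁻¹' Set.univ.pi F =
        {l | ∀ n j, l n j ∈ if j = s n then F n else Set.univ} := by
      ext l
      simp only [Set.mem_preimage, Set.mem_univ_pi, Set.mem_ofPred_eq]
      refine forall_congr' fun n => ⟨fun h j => ?_, fun h => by simpa using h (s n)⟩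
      split_ifs with hj
      · rw [hj]
        exact h
      · trivial
    apply Complex.ofReal_injective
    rw [hset, hμ _ fun n j => by split_ifs <;> simp [hF], hP.apply_pi s F hF,
      ← hT.trace_eq s fun n => (M n (s n)).toFun (F n)]
    congr 3
    funext p
    split_ifs with hp
    · rw [hp]
    · exact POVM.univ_eq_one _
  have h := congrArg (fun m : SignedMeasure (∀ n, Λ n) => m E) key
  rwa [VectorMeasure.map_apply _ hf hE, Measure.toSignedMeasure_apply_measurable hE] at h

omit [∀ n, CompleteSpace (H n)] in
theorem IsSourceMeasure.isNormalizedBounded {ρ : HilbertTensor H →L[ℂ] HilbertTensor H}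
    {T : SourceSpace S H →L[ℂ] SourceSpace S H} {M : ∀ n, Fin (S n) → POVM (Λ n) (H n)}
    {P : (∀ n, Fin (S n)) → Measure (∀ n, Λ n)} {μ : SignedMeasure (∀ n, Fin (S n) → Λ n)}
    (hμ : IsSourceMeasure T M μ) (hT : IsSourceOperator ρ T) (hP : IsQuantumScenario ρ M P)
    (s : ∀ n, Fin (S n)) : IsNormalizedBounded μ := by
  have := hP.isProbabilityMeasure s
  have h := hμ.marginal_eq hT hP s MeasurableSet.univ
  exact isNormalizedBounded_of_univ (by simpa using h)

/-- A real-valued measure with the distributions of the scenario as marginals is an LqHV model with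
deterministic conditional distributions. -/
theorem admitsLqHV_of_marginals {P : (∀ n, Fin (S n)) → Measure (∀ n, Λ n)}
    {μ : SignedMeasure (∀ n, Fin (S n) → Λ n)} (hμ : IsNormalizedBounded μ)
    (h : ∀ (s : ∀ n, Fin (S n)) (E : Set (∀ n, Λ n)), MeasurableSet E →
      μ {l | (fun n => l n (s n)) ∈ E} = (P s).real E) : AdmitsLqHV P := by
  have hev : ∀ n (j : Fin (S n)), Measurable fun l : ∀ n, Fin (S n) → Λ n => l n j :=
    fun n j => (measurable_pi_apply j).comp (measurable_pi_apply n)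
  refine ⟨∀ n, Fin (S n) → Λ n, inferInstance, μ, fun n j l => Measure.dirac (l n j), hμ,
    fun n j => Eventually.of_forall fun l => inferInstance, fun n j F hF => ?_, fun s F hF => ?_⟩
  · exact (Measure.measurable_coe hF).comp (Measure.measurable_dirac.comp (hev n j))
  · have hE := MeasurableSet.univ_pi hF
    have hA : MeasurableSet {l : ∀ n, Fin (S n) → Λ n | (fun n => l n (s n)) ∈ Set.univ.pi F} :=
      (measurable_pi_lambda _ fun n => hev n (s n)) hE
    rw [← h s _ hE, ← integral_indicator_one μ hA]
    congr 1
    funext l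
    have e1 : ∀ n, (Measure.dirac (l n (s n))).real (F n) =
        (F n).indicator (fun _ => (1 : ℝ)) (l n (s n)) := fun n => by
      rw [measureReal_def, Measure.dirac_apply' _ (hF n)]
      by_cases hl : l n (s n) ∈ F n <;> simp [hl]
    simp only [e1]
    by_cases hl : ∀ n, l n (s n) ∈ F n
    · rw [Set.indicator_of_mem (by simpa using hl),
        Finset.prod_eq_one fun n _ => Set.indicator_of_mem (hl n) _]
    · rw [Set.indicator_of_notMem (by simpa using hl)]
      push Not at hl
      obtain ⟨n, hn⟩ := hl
      exact (Finset.prod_eq_zero (Finset.mem_univ n) (Set.indicator_of_notMem hn _)).symm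

end Scenario

end QCorr

end

/-! ### The main theorem -/

open QCorr in
theorem theorem2 {N : ℕ} {H : Fin N → Type*} [∀ n, NormedAddCommGroup (H n)]
    [∀ n, InnerProductSpace ℂ (H n)] [∀ n, CompleteSpace (H n)]
    [∀ n, TopologicalSpace.SeparableSpace (H n)]
    (ρ : HilbertTensor H →L[ℂ] HilbertTensor H) (hρ : IsState ρ)
    (S : Fin N → ℕ) (hS : ∀ n, 1 ≤ S n)
    {Λ : Fin N → Type*} [∀ n, MeasurableSpace (Λ n)] [∀ n, StandardBorelSpace (Λ n)]
    (M : ∀ n, Fin (S n) → POVM (Λ n) (H n)) :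
    (∃! P : (∀ n, Fin (S n)) → Measure (∀ n, Λ n), IsQuantumScenario ρ M P) ∧
    (∃ T : SourceSpace S H →L[ℂ] SourceSpace S H, IsSourceOperator ρ T) ∧
    ∀ P : (∀ n, Fin (S n)) → Measure (∀ n, Λ n), IsQuantumScenario ρ M P →
      AdmitsLqHV P ∧
      ∀ T : SourceSpace S H →L[ℂ] SourceSpace S H, IsSourceOperator ρ T →
        ∃ μ : SignedMeasure (∀ n, Fin (S n) → Λ n),
          IsSourceMeasure T M μ ∧ IsNormalizedBounded μ ∧
          ∀ (s : ∀ n, Fin (S n)) (E : Set (∀ n, Λ n)), MeasurableSet E →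
            μ {l | (fun n => l n (s n)) ∈ E} = (P s).real E := by
  have hsource : ∀ P : (∀ n, Fin (S n)) → Measure (∀ n, Λ n), IsQuantumScenario ρ M P →
      ∀ T : SourceSpace S H →L[ℂ] SourceSpace S H, IsSourceOperator ρ T →
        ∃ μ : SignedMeasure (∀ n, Fin (S n) → Λ n),
          IsSourceMeasure T M μ ∧ IsNormalizedBounded μ ∧
          ∀ (s : ∀ n, Fin (S n)) (E : Set (∀ n, Λ n)), MeasurableSet E →
            μ {l | (fun n => l n (s n)) ∈ E} = (P s).real E := fun P hP T hT => by
    obtain ⟨μ, hμ⟩ := exists_isSourceMeasure hT.isSelfAdjoint hT.traceClass M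
    -- Any setting shows `μ(univ) = 1`, as each marginal has mass one; `1 ≤ S n` supplies a setting.
    exact ⟨μ, hμ, hμ.isNormalizedBounded hT hP fun n => ⟨0, hS n⟩,
      fun s E hE => hμ.marginal_eq hT hP s hE⟩
  obtain ⟨P, hP⟩ := exists_isQuantumScenario hρ M
  obtain ⟨T, hT⟩ := exists_isSourceOperator (S := S) hρ hS
  refine ⟨⟨P, hP, fun Q hQ => hQ.eq hP⟩, ⟨T, hT⟩, fun Q hQ => ⟨?_, hsource Q hQ⟩⟩
  obtain ⟨μ, -, hμ, hmarg⟩ := hsource Q hQ T hT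
  exact admitsLqHV_of_marginals hμ hmarg
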